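/- For every integer $n\ge 3$ there is a constant $c(n)>0$ with the following property. Let $(a_k)_{k\ge 0}$ be a sequence of real numbers such that $\sum_{k\ge 1} a_k k^{1-\frac n2}$ converges absolutely (for nonnegative $a_k$: $\sum_{k\ge 1} a_k k^{1-\frac n2}<\infty$). Then there is a smooth function $f:\mathbb R^n\to\mathbb R$ such that the Riemannian metric $g=e^{2f}\,\mathrm{eucl}$ on $\mathbb R^n$, where $\mathrm{eucl}$ is the Euclidean metric, is complete, has sectional curvature bounded from below, and satisfies $$\int_{\mathbb R^n}\sigma_-(g)^{\frac n2}\,d\mathrm{vol}_g<\infty$$ and $$\mathrm{vol}_g\, B(o,2^k)\ \ge\ c(n)\,a_k\,(2^k)^n\qquad\text{for all integers } k\ge 0 .$$ Here $\sigma_-(g)(x)=0$ if all sectional curvatures of $g$ at $x$ are nonnegative, and otherwise $-\sigma_-(g)(x)$ is the lowest sectional curvature of $g$ at $x$; $o$ is the origin of $\mathbb R^n$, and $B(o,r)$ is the open ball of radius $r$ about $o$ for the geodesic distance of $g$. -/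

import Mathlib

open scoped Manifold ContDiff ENNReal

noncomputable section

namespace RiemannRn

/-- Smooth Riemannian metrics on an inner product space `F`, regarded as a manifold with its
standard global chart. -/
abbrev SmoothMetric (F : Type*) [NormedAddCommGroup F] [InnerProductSpace ℝ F] : Type _ :=
  Bundle.ContMDiffRiemannianMetric 𝓘(ℝ, F) ∞ F (fun x : F => TangentSpace 𝓘(ℝ, F) x)

open Bundle in
/-- The geodesic distance of `g`: the infimum of the `g`-lengths of `C¹` paths. -/
def SmoothMetric.geodDist {F : Type*} [NormedAddCommGroup F] [InnerProductSpace ℝ F]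
    (g : SmoothMetric F) (x y : F) : ℝ≥0∞ :=
  letI : RiemannianBundle (fun x : F => TangentSpace 𝓘(ℝ, F) x) := ⟨g.toRiemannianMetric⟩
  Manifold.riemannianEDist 𝓘(ℝ, F) x y

/-- The value `g_x(v, w)`, tangent vectors of `F` at `x` being identified with vectors of `F`. -/
def SmoothMetric.form {F : Type*} [NormedAddCommGroup F] [InnerProductSpace ℝ F]
    (g : SmoothMetric F) (x v w : F) : ℝ :=
  g.inner x v w

/-- A smooth Riemannian metric on `ℝⁿ`. -/
abbrev Metric (n : ℕ) : Type := SmoothMetric (EuclideanSpace ℝ (Fin n))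

/-- The coordinate vector `∂ᵢ`. -/
def coordVec {n : ℕ} (i : Fin n) : EuclideanSpace ℝ (Fin n) :=
  EuclideanSpace.single i (1 : ℝ)

/-- The partial derivative `∂ᵢ u`. -/
def pderiv {n : ℕ} (i : Fin n) (u : EuclideanSpace ℝ (Fin n) → ℝ)
    (x : EuclideanSpace ℝ (Fin n)) : ℝ :=
  fderiv ℝ u x (coordVec i)

/-- The matrix `(g_{ij}(x))` of the metric in the standard coordinates. -/
def Metric.coeff {n : ℕ} (g : Metric n) (x : EuclideanSpace ℝ (Fin n)) :
    Matrix (Fin n) (Fin n) ℝ :=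
  Matrix.of fun i j => SmoothMetric.form g x (coordVec i) (coordVec j)

/-- The Christoffel symbol `Γᵏᵢⱼ` of the Levi-Civita connection,
`Γᵏᵢⱼ = ½ ∑ₗ gᵏˡ (∂ᵢ gⱼₗ + ∂ⱼ gᵢₗ - ∂ₗ gᵢⱼ)`. -/
def Metric.christoffel {n : ℕ} (g : Metric n) (k i j : Fin n)
    (x : EuclideanSpace ℝ (Fin n)) : ℝ :=
  (1 / 2 : ℝ) * ∑ l, (g.coeff x)⁻¹ k l *
    (pderiv i (fun y => g.coeff y j l) x + pderiv j (fun y => g.coeff y i l) x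
      - pderiv l (fun y => g.coeff y i j) x)

/-- The `l`-th component of `R(∂ᵢ, ∂ⱼ)∂ₖ`, where
`R(X, Y)Z = ∇_X ∇_Y Z - ∇_Y ∇_X Z - ∇_[X,Y] Z`. -/
def Metric.curvComp {n : ℕ} (g : Metric n) (l i j k : Fin n)
    (x : EuclideanSpace ℝ (Fin n)) : ℝ :=
  pderiv i (g.christoffel l j k) x - pderiv j (g.christoffel l i k) x
    + ∑ m, (g.christoffel l i m x * g.christoffel m j k x
      - g.christoffel l j m x * g.christoffel m i k x)

/-- The vector `R(u, v)w` at the point `x`. -/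
def Metric.curv {n : ℕ} (g : Metric n) (x u v w : EuclideanSpace ℝ (Fin n)) :
    EuclideanSpace ℝ (Fin n) :=
  WithLp.toLp 2 fun l => ∑ i, ∑ j, ∑ k, g.curvComp l i j k x * u i * v j * w k

/-- The sectional curvature at `x` of the plane spanned by the linearly independent vectors `u` and
`v`: `g(R(u,v)v, u) / (g(u,u) g(v,v) - g(u,v)²)`. -/
def Metric.sec {n : ℕ} (g : Metric n) (x u v : EuclideanSpace ℝ (Fin n)) : ℝ :=
  SmoothMetric.form g x (g.curv x u v v) u / (SmoothMetric.form g x u u * SmoothMetric.form g x v v - SmoothMetric.form g x u v ^ 2)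

/-- The set of all sectional curvatures of `g` at `x`. -/
def Metric.secSet {n : ℕ} (g : Metric n) (x : EuclideanSpace ℝ (Fin n)) : Set ℝ :=
  {κ | ∃ u v : EuclideanSpace ℝ (Fin n), LinearIndependent ℝ ![u, v] ∧ κ = g.sec x u v}

/-- The sectional curvature of `g` is bounded from below. -/
def Metric.SecBoundedBelow {n : ℕ} (g : Metric n) : Prop :=
  ∃ κ₀ : ℝ, ∀ x : EuclideanSpace ℝ (Fin n), ∀ κ ∈ g.secSet x, κ₀ ≤ κ

open Classical in
/-- `σ₋(g)(x)` is `0` if all sectional curvatures at `x` are nonnegative; otherwise `-σ₋(g)(x)` is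
the lowest sectional curvature at `x`. -/
def Metric.sigmaMinus {n : ℕ} (g : Metric n) (x : EuclideanSpace ℝ (Fin n)) : ℝ :=
  if ∀ κ ∈ g.secSet x, 0 ≤ κ then 0 else -sInf (g.secSet x)

/-- The Riemannian volume measure `√(det g) dx`. -/
def Metric.vol {n : ℕ} (g : Metric n) : MeasureTheory.Measure (EuclideanSpace ℝ (Fin n)) :=
  MeasureTheory.volume.withDensity fun x => ENNReal.ofReal (Real.sqrt (g.coeff x).det)

/-- The open geodesic ball. -/
def Metric.ball {n : ℕ} (g : Metric n) (x : EuclideanSpace ℝ (Fin n)) (r : ℝ) :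
    Set (EuclideanSpace ℝ (Fin n)) :=
  {y | SmoothMetric.geodDist g x y < ENNReal.ofReal r}

/-- The metric `g` is complete: Cauchy sequences for its geodesic distance converge. -/
def Metric.IsComplete {n : ℕ} (g : Metric n) : Prop :=
  ∀ p : ℕ → EuclideanSpace ℝ (Fin n),
    (∀ ε : ℝ≥0∞, 0 < ε → ∃ N, ∀ i ≥ N, ∀ j ≥ N, SmoothMetric.geodDist g (p i) (p j) < ε) →
    ∃ q, Filter.Tendsto (fun i => SmoothMetric.geodDist g (p i) q) Filter.atTop (nhds 0)

/-- `g = e^{2f} eucl`. -/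
def Metric.IsConformal {n : ℕ} (g : Metric n) (f : EuclideanSpace ℝ (Fin n) → ℝ) : Prop :=
  ∀ x v w : EuclideanSpace ℝ (Fin n), SmoothMetric.form g x v w = Real.exp (2 * f x) * inner ℝ v w

end RiemannRn

end

/-! For each `k`, glue `N k = ⌊a k⌋₊` round spheres of size about `2 ^ k` through necks to flat
space, within distance `2 ^ k` of the origin. Each carries volume comparable to `(2 ^ k) ^ n`, which
settles the volume bound when `a k ≥ 1`; a flat half space settles it when `a k ≤ 1`.

A sphere with its neck (a bubble) is a conformal factor: with `q = |x - c|²`, the exponent is a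
constant minus `log (b² + q)` near `c` (the stereographic sphere), vanishes far out, and its slope
in `log (b² + q)` rises from `-1` to `0` over a neck of logarithmic length `T`. Negative curvature
comes only from the convexity of this transition; before conformal rescaling it is at most of order
`1 / (T (b² + q))` (`neg_le_sec`, `neg_bubbleDefect_le_sec`). Since `σ₋^(n/2) dvol` is conformally
invariant, its integral is a Euclidean one: about `T` logarithmic shells contribute about `T^(-n/2)`
each, so a bubble costs `T^(1 - n/2)` (`lintegral_bubbleDefect_le`). Taking `T = (k + 1) / 4`, the
total cost is a multiple of `∑ N k (k + 1)^(1 - n/2)`, which converges.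

The curvature bound from below is kept by using one scale `1 / l` for all necks. A neck then has
Euclidean radius `e^(T/2) / l` and adds length of order `e^T / l` to a path through it. As `1/4 <
log 2` and summability makes `N k` grow at most polynomially, a large `l` makes both small compared
with `2 ^ k`, even with `N k` bubbles side by side (`exists_scale_of_le`). Three axes are needed:
one separates the sizes, one the bubbles of equal size, and along the third each bubble is reached
without meeting another (`mem_ball_of_core`, `card_mul_le_vol_ball`). Completeness follows from `f ≥
0`. -/

namespace RiemannRn

open Bundle Manifold MeasureTheory Set

/-! ### Conformally flat metrics as smooth Riemannian metrics. -/

section ConformalMetric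

variable {F : Type*} [NormedAddCommGroup F] [InnerProductSpace ℝ F]

variable (F) in
/-- The inner product of `F` as an element of `F →L[ℝ] F →L[ℝ] ℝ`. -/
noncomputable def innerCLM : F →L[ℝ] F →L[ℝ] ℝ := innerSL ℝ

/-- The bilinear form `e^{2f} eucl` on the tangent space at `x`. -/
noncomputable def conformalInner (f : F → ℝ) (x : F) :
    TangentSpace 𝓘(ℝ, F) x →L[ℝ] TangentSpace 𝓘(ℝ, F) x →L[ℝ] ℝ :=
  (Real.exp (2 * f x) • innerCLM F : F →L[ℝ] F →L[ℝ] ℝ)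

theorem contDiff_exp_smul_const {G : Type*} [NormedAddCommGroup G] [NormedSpace ℝ G]
    {f : F → ℝ} (hf : ContDiff ℝ ∞ f) (L : G) :
    ContDiff ℝ ∞ fun x => Real.exp (2 * f x) • L :=
  (Real.contDiff_exp.comp (contDiff_const.mul hf)).smul contDiff_const

/-- The metric `e^{2f} eucl`. -/
noncomputable def conformalMetric (f : F → ℝ) (hf : ContDiff ℝ ∞ f) : SmoothMetric F where
  inner x := conformalInner f x
  symm x v w := by
    change Real.exp (2 * f x) * inner ℝ (v : F) w = Real.exp (2 * f x) * inner ℝ (w : F) v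
    rw [real_inner_comm]
  pos x v hv := mul_pos (Real.exp_pos _) (real_inner_self_pos.2 hv)
  isVonNBounded x := by
    change Bornology.IsVonNBounded ℝ {v : F | Real.exp (2 * f x) * inner ℝ v v < 1}
    refine (NormedSpace.isVonNBounded_ball ℝ F (Real.exp (-f x))).subset fun v hv => ?_
    have hv' : Real.exp (2 * f x) * inner ℝ v v < 1 := hv
    rw [mem_ball_zero_iff]
    rw [real_inner_self_eq_norm_sq, two_mul, Real.exp_add] at hv'
    have h1 : Real.exp (f x) * ‖v‖ < 1 := by
      have : 0 ≤ Real.exp (f x) * ‖v‖ := by positivity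
      nlinarith
    rw [Real.exp_neg, ← one_div, lt_div_iff₀ (Real.exp_pos _), mul_comm]
    exact h1
  contMDiff := by
    intro x
    rw [contMDiffAt_section]
    have h : ContMDiffAt 𝓘(ℝ, F) 𝓘(ℝ, F →L[ℝ] F →L[ℝ] ℝ) ∞
        (fun x => Real.exp (2 * f x) • innerCLM F) x := by
      rw [contMDiffAt_iff_contDiffAt]
      exact (contDiff_exp_smul_const hf (innerCLM F)).contDiffAt
    -- In the global chart the trivialization of the bundle of bilinear forms is the identity, so
    -- only the smoothness of `e^(2f)` times a constant form is at stake.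
    convert! h using 1
    ext y v w
    simp [hom_trivializationAt_apply, ContinuousLinearMap.inCoordinates]
    rw [Trivialization.linearMapAt_apply, if_pos]
    · rw [hom_trivializationAt_apply]
      simp only [ContinuousLinearMap.inCoordinates]
      simp
      rfl
    · rw [hom_trivializationAt_baseSet]
      exact ⟨by simp only [TangentBundle.trivializationAt_baseSet]; exact mem_univ _, mem_univ _⟩

theorem form_conformalMetric (f : F → ℝ) (hf : ContDiff ℝ ∞ f) (x v w : F) :
    (conformalMetric f hf).form x v w = Real.exp (2 * f x) * inner ℝ v w := rfl

theorem enorm_tangentSpace_of_form (g : SmoothMetric F) (x : F) (v : TangentSpace 𝓘(ℝ, F) x) :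
    letI : RiemannianBundle (fun x : F => TangentSpace 𝓘(ℝ, F) x) := ⟨g.toRiemannianMetric⟩
    ‖v‖ₑ = ENNReal.ofReal (Real.sqrt (g.form x v v)) := by
  let _ : RiemannianBundle (fun x : F => TangentSpace 𝓘(ℝ, F) x) := ⟨g.toRiemannianMetric⟩
  rw [← ofReal_norm, norm_eq_sqrt_real_inner]
  rfl

end ConformalMetric

end RiemannRn

/-! ### Geodesic distance and completeness of conformal metrics. -/

namespace RiemannRn

open Bundle Manifold MeasureTheory Set

section ConformalDistance

variable {F : Type*} [NormedAddCommGroup F] [InnerProductSpace ℝ F]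

theorem geodDist_triangle (g : SmoothMetric F) (x y z : F) :
    g.geodDist x z ≤ g.geodDist x y + g.geodDist y z := by
  let _ : RiemannianBundle (fun x : F => TangentSpace 𝓘(ℝ, F) x) := ⟨g.toRiemannianMetric⟩
  exact riemannianEDist_triangle

theorem geodDist_comm (g : SmoothMetric F) (x y : F) : g.geodDist x y = g.geodDist y x := by
  let _ : RiemannianBundle (fun x : F => TangentSpace 𝓘(ℝ, F) x) := ⟨g.toRiemannianMetric⟩
  exact riemannianEDist_comm

theorem sqrt_form_conformalMetric (f : F → ℝ) (hf : ContDiff ℝ ∞ f) (x v : F) :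
    Real.sqrt ((conformalMetric f hf).form x v v) = Real.exp (f x) * ‖v‖ := by
  rw [form_conformalMetric, real_inner_self_eq_norm_sq, two_mul, Real.exp_add, ← sq, ← mul_pow,
    Real.sqrt_sq (by positivity)]

theorem geodDist_conformalMetric_le_lintegral (f : F → ℝ) (hf : ContDiff ℝ ∞ f) (x v : F)
    {L : ℝ} (hL : 0 ≤ L) :
    (conformalMetric f hf).geodDist x (x + L • v) ≤
      ∫⁻ t in Icc 0 L, ENNReal.ofReal (Real.exp (f (x + t • v)) * ‖v‖) := by
  let _ : RiemannianBundle (fun x : F => TangentSpace 𝓘(ℝ, F) x) :=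
    ⟨(conformalMetric f hf).toRiemannianMetric⟩
  have hγ : ContDiff ℝ 1 fun t : ℝ => x + t • v := by fun_prop
  have h : riemannianEDist 𝓘(ℝ, F) x (x + L • v) ≤
      pathELength 𝓘(ℝ, F) (fun t : ℝ => x + t • v) 0 L := by
    apply riemannianEDist_le_pathELength _ (by simp) rfl hL
    rw [contMDiffOn_iff_contDiffOn]
    exact hγ.contDiffOn
  refine h.trans (le_of_eq ?_)
  rw [pathELength_eq_lintegral_mfderiv_Icc]
  refine lintegral_congr fun t => ?_
  rw [enorm_tangentSpace_of_form]
  congr 1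
  have h1 : HasDerivAt (fun t : ℝ => x + t • v) ((1 : ℝ) • v) t :=
    ((hasDerivAt_id t).smul_const v).const_add x
  have h2 : (fderiv ℝ (fun t : ℝ => x + t • v) t 1 : F) = v := by
    rw [fderiv_apply_one_eq_deriv, h1.deriv, one_smul]
  have h3 := sqrt_form_conformalMetric f hf (x + t • v) (fderiv ℝ (fun t : ℝ => x + t • v) t 1)
  rw [h2] at h3
  rw [← h3]
  rw [mfderiv_eq_fderiv]
  exact congrArg (fun w : F => Real.sqrt ((conformalMetric f hf).form (x + t • v) w w)) h2

/-- A conformal factor `e^f ≥ 1` can only lengthen paths. This reduces completeness to that of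
Euclidean space. -/
theorem edist_le_geodDist_conformalMetric (f : F → ℝ) (hf : ContDiff ℝ ∞ f) (h0 : ∀ x, 0 ≤ f x)
    (x y : F) : edist x y ≤ (conformalMetric f hf).geodDist x y := by
  -- The Euclidean distance is itself an infimum of lengths over the same paths, so the two infima
  -- compare path by path.
  have hE : edist x y = riemannianEDist 𝓘(ℝ, F) x y := IsRiemannianManifold.out x y
  rw [hE]
  have hle : ∀ (z : F) (v : TangentSpace 𝓘(ℝ, F) z), ‖v‖ₑ ≤
      ENNReal.ofReal (Real.sqrt ((conformalMetric f hf).form z v v)) := by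
    intro z v
    have key : ∀ u : F, ‖u‖ₑ ≤
        ENNReal.ofReal (Real.sqrt ((conformalMetric f hf).form z u u)) := by
      intro u
      rw [sqrt_form_conformalMetric, ← ofReal_norm]
      exact ENNReal.ofReal_le_ofReal
        (le_mul_of_one_le_left (norm_nonneg _) (Real.one_le_exp (h0 z)))
    exact enorm_tangentSpace_vectorSpace.trans_le (key v)
  rw [riemannianEDist, SmoothMetric.geodDist, riemannianEDist]
  refine iInf₂_mono fun γ hγ => lintegral_mono fun t => ?_
  refine (hle _ _).trans (le_of_eq ?_)
  exact (enorm_tangentSpace_of_form (conformalMetric f hf) _ _).symm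

theorem geodDist_conformalMetric_le_ofReal (f : F → ℝ) (hf : ContDiff ℝ ∞ f) (x v : F)
    {L M : ℝ} (hL : 0 ≤ L) (hM : ∀ t ∈ Icc 0 L, Real.exp (f (x + t • v)) * ‖v‖ ≤ M) :
    (conformalMetric f hf).geodDist x (x + L • v) ≤ ENNReal.ofReal (M * L) := by
  have hM0 : 0 ≤ M := le_trans (by positivity) (hM 0 ⟨le_rfl, hL⟩)
  refine (geodDist_conformalMetric_le_lintegral f hf x v hL).trans ?_
  calc ∫⁻ t in Icc 0 L, ENNReal.ofReal (Real.exp (f (x + t • v)) * ‖v‖)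
      ≤ ∫⁻ _ in Icc 0 L, ENNReal.ofReal M :=
        setLIntegral_mono' measurableSet_Icc fun t ht => ENNReal.ofReal_le_ofReal (hM t ht)
    _ = ENNReal.ofReal (M * L) := by
        rw [setLIntegral_const, Real.volume_Icc, sub_zero, ENNReal.ofReal_mul hM0]

theorem tendsto_geodDist_conformalMetric (f : F → ℝ) (hf : ContDiff ℝ ∞ f) {p : ℕ → F} {q : F}
    (hp : Filter.Tendsto p Filter.atTop (nhds q)) :
    Filter.Tendsto (fun i => (conformalMetric f hf).geodDist (p i) q) Filter.atTop (nhds 0) := by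
  obtain ⟨δ, hδ, hball⟩ := Metric.eventually_nhds_iff_ball.1
    (hf.continuous.continuousAt.eventually_lt (continuousAt_const (y := f q + 1))
      (by linarith : f q < f q + 1))
  have hlim : Filter.Tendsto (fun i => ENNReal.ofReal (Real.exp (f q + 1) * ‖p i - q‖ * 1))
      Filter.atTop (nhds 0) := by
    have h1 : Filter.Tendsto (fun i => Real.exp (f q + 1) * ‖p i - q‖ * 1) Filter.atTop
        (nhds 0) := by
      simpa using (tendsto_iff_norm_sub_tendsto_zero.1 hp).const_mul (Real.exp (f q + 1))
    simpa using ENNReal.tendsto_ofReal h1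
  refine tendsto_of_tendsto_of_tendsto_of_le_of_le' tendsto_const_nhds hlim
    (Filter.Eventually.of_forall fun _ => zero_le) ?_
  filter_upwards [hp (Metric.ball_mem_nhds q hδ)] with i hi
  rw [geodDist_comm]
  have h := geodDist_conformalMetric_le_ofReal f hf q (p i - q) (L := 1)
    (M := Real.exp (f q + 1) * ‖p i - q‖) zero_le_one fun t ht => by
      refine mul_le_mul_of_nonneg_right (Real.exp_le_exp.2 (hball _ ?_).le) (norm_nonneg _)
      have hi' : ‖p i - q‖ < δ := by rwa [← dist_eq_norm]
      rw [Metric.mem_ball, dist_eq_norm, add_sub_cancel_left, norm_smul, Real.norm_eq_abs,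
        abs_of_nonneg ht.1]
      exact (mul_le_of_le_one_left (norm_nonneg _) ht.2).trans_lt hi'
  simpa using h

end ConformalDistance

theorem isComplete_conformalMetric {n : ℕ} (f : EuclideanSpace ℝ (Fin n) → ℝ)
    (hf : ContDiff ℝ ∞ f) (h0 : ∀ x, 0 ≤ f x) : Metric.IsComplete (conformalMetric f hf) := by
  intro p hp
  have hc : CauchySeq p := by
    rw [EMetric.cauchySeq_iff]
    intro ε hε
    obtain ⟨N, hN⟩ := hp ε hε
    exact ⟨N, fun i hi j hj =>
      (edist_le_geodDist_conformalMetric f hf h0 _ _).trans_lt (hN i hi j hj)⟩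
  obtain ⟨q, hq⟩ := cauchySeq_tendsto_of_complete hc
  exact ⟨q, tendsto_geodDist_conformalMetric f hf hq⟩

end RiemannRn

/-! ### Curvature of conformally flat metrics. -/

namespace RiemannRn

open MeasureTheory Set

section ConformalCurvature

variable {n : ℕ} {f : EuclideanSpace ℝ (Fin n) → ℝ} {g : Metric n}

theorem inner_coordVec (i j : Fin n) :
    inner ℝ (coordVec i) (coordVec j) = if i = j then (1 : ℝ) else 0 := by
  simp [coordVec, EuclideanSpace.inner_single_left]

theorem Metric.IsConformal.coeff (hg : g.IsConformal f) (x : EuclideanSpace ℝ (Fin n))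
    (i j : Fin n) : g.coeff x i j = if i = j then Real.exp (2 * f x) else 0 := by
  simp [Metric.coeff, hg x, inner_coordVec]

theorem Metric.IsConformal.coeff_eq (hg : g.IsConformal f) (x : EuclideanSpace ℝ (Fin n)) :
    g.coeff x = Real.exp (2 * f x) • (1 : Matrix (Fin n) (Fin n) ℝ) := by
  ext i j
  rw [hg.coeff, Matrix.smul_apply, Matrix.one_apply]
  simp

theorem Metric.IsConformal.coeff_inv (hg : g.IsConformal f) (x : EuclideanSpace ℝ (Fin n)) :
    (g.coeff x)⁻¹ = Real.exp (-(2 * f x)) • (1 : Matrix (Fin n) (Fin n) ℝ) := by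
  refine Matrix.inv_eq_right_inv ?_
  rw [hg.coeff_eq, smul_mul_smul_comm, ← Real.exp_add]
  simp

theorem Metric.IsConformal.sqrt_det_coeff (hg : g.IsConformal f)
    (x : EuclideanSpace ℝ (Fin n)) :
    Real.sqrt (g.coeff x).det = Real.exp (f x) ^ n := by
  rw [hg.coeff_eq, Matrix.det_smul, Matrix.det_one, mul_one, Fintype.card_fin, two_mul,
    Real.exp_add, ← sq, ← pow_mul, mul_comm 2 n, pow_mul, Real.sqrt_sq (by positivity)]

theorem pderiv_exp_two_mul (hf : ContDiff ℝ ∞ f) (x : EuclideanSpace ℝ (Fin n)) (i : Fin n) :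
    pderiv i (fun y => Real.exp (2 * f y)) x = Real.exp (2 * f x) * (2 * pderiv i f x) := by
  have hd : HasFDerivAt f (fderiv ℝ f x) x :=
    (hf.differentiable (by simp)).differentiableAt.hasFDerivAt
  have := ((hd.const_mul (2 : ℝ)).exp).fderiv
  simp [pderiv, this]

theorem pderiv_coeff (hg : g.IsConformal f) (hf : ContDiff ℝ ∞ f)
    (x : EuclideanSpace ℝ (Fin n)) (i j k : Fin n) :
    pderiv i (fun y => g.coeff y j k) x =
      if j = k then Real.exp (2 * f x) * (2 * pderiv i f x) else 0 := by
  simp only [hg.coeff]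
  split_ifs with h
  · exact pderiv_exp_two_mul hf x i
  · simp [pderiv]

theorem Metric.IsConformal.christoffel (hg : g.IsConformal f) (hf : ContDiff ℝ ∞ f)
    (k i j : Fin n) (x : EuclideanSpace ℝ (Fin n)) :
    g.christoffel k i j x = (if j = k then pderiv i f x else 0)
      + (if i = k then pderiv j f x else 0) - (if i = j then pderiv k f x else 0) := by
  have he : Real.exp (-(2 * f x)) * Real.exp (2 * f x) = 1 := by
    rw [← Real.exp_add]; simp
  rw [Metric.christoffel, Finset.sum_eq_single k]
  · rw [hg.coeff_inv, pderiv_coeff hg hf, pderiv_coeff hg hf, pderiv_coeff hg hf]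
    simp only [Matrix.smul_apply, Matrix.one_apply_eq, smul_eq_mul, mul_one]
    have hite : ∀ (p : Prop) [Decidable p] (a : ℝ),
        (if p then Real.exp (2 * f x) * (2 * a) else 0) =
          Real.exp (2 * f x) * (2 * if p then a else 0) := by
      intro p _ a
      split_ifs <;> simp
    rw [hite, hite, hite]
    linear_combination ((if j = k then pderiv i f x else 0)
      + (if i = k then pderiv j f x else 0) - (if i = j then pderiv k f x else 0)) * he
  · intro l _ hl
    rw [hg.coeff_inv]
    simp [Matrix.one_apply_ne hl.symm]
  · simp

theorem differentiable_pderiv (hf : ContDiff ℝ ∞ f) (i : Fin n) :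
    Differentiable ℝ (pderiv i f) := by
  have : ContDiff ℝ ∞ (pderiv i f) :=
    (hf.fderiv_right (m := ∞) (by simp)).clm_apply contDiff_const
  exact this.differentiable (by simp)

theorem Metric.IsConformal.pderiv_christoffel (hg : g.IsConformal f) (hf : ContDiff ℝ ∞ f)
    (m k i j : Fin n) (x : EuclideanSpace ℝ (Fin n)) :
    pderiv m (g.christoffel k i j) x = (if j = k then pderiv m (pderiv i f) x else 0)
      + (if i = k then pderiv m (pderiv j f) x else 0)
      - (if i = j then pderiv m (pderiv k f) x else 0) := by
  have hd : ∀ (p : Prop) [Decidable p] (l : Fin n), HasFDerivAt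
      (fun y => if p then pderiv l f y else 0) (if p then fderiv ℝ (pderiv l f) x else 0) x := by
    intro p _ l
    split_ifs
    · exact (differentiable_pderiv hf l).differentiableAt.hasFDerivAt
    · exact hasFDerivAt_const _ _
  have hfun : g.christoffel k i j = fun x => (if j = k then pderiv i f x else 0)
      + (if i = k then pderiv j f x else 0) - (if i = j then pderiv k f x else 0) :=
    funext fun y => hg.christoffel hf k i j y
  have h := (((hd (j = k) i).add (hd (i = k) j)).sub (hd (i = j) k)).fderiv
  rw [hfun]
  unfold pderiv at h ⊢
  erw [h]
  simp only [sub_apply, add_apply]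
  split_ifs <;> simp

/-- Summation of products of conformal Christoffel symbols. -/
theorem sum_christoffel_mul (p : Fin n → ℝ) (l i j k : Fin n) :
    ∑ m, (((if m = l then p i else 0) + (if i = l then p m else 0) - (if i = m then p l else 0)) *
      ((if k = m then p j else 0) + (if j = m then p k else 0) - (if j = k then p m else 0))) =
    (if k = l then p i * p j else 0) + (if j = l then p i * p k else 0)
      + 2 * (if i = l then p j * p k else 0)
      - (if i = l then (if j = k then ∑ m, p m ^ 2 else 0) else 0)
      - (if i = k then p j * p l else 0) - (if i = j then p k * p l else 0) := by
  have h1 : ∀ m, (((if m = l then p i else 0) + (if i = l then p m else 0)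
        - (if i = m then p l else 0)) *
      ((if k = m then p j else 0) + (if j = m then p k else 0) - (if j = k then p m else 0))) =
      (if m = l then p i * ((if k = l then p j else 0) + (if j = l then p k else 0) -
        (if j = k then p l else 0)) else 0)
      + (if i = l then (if m = k then p k * p j else 0) + (if m = j then p j * p k else 0)
        - (if j = k then p m ^ 2 else 0) else 0)
      - (if m = i then p l * ((if k = i then p j else 0) + (if j = i then p k else 0) -
        (if j = k then p i else 0)) else 0) := by
    intro m
    grind
  rw [Finset.sum_congr rfl fun m _ => h1 m, Finset.sum_sub_distrib, Finset.sum_add_distrib,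
    Finset.sum_ite_eq', Finset.sum_ite_eq']
  by_cases hil : i = l
  · subst hil
    simp only [if_true, Finset.mem_univ, Finset.sum_sub_distrib, Finset.sum_add_distrib,
      Finset.sum_ite_eq']
    by_cases hjk : j = k
    · subst hjk
      simp only [if_true]
      split_ifs <;> first | ring1 | grind
    · simp only [if_neg hjk, Finset.sum_const_zero]
      split_ifs <;> first | ring1 | grind
  · simp only [if_neg hil, Finset.sum_const_zero, Finset.mem_univ, if_true]
    split_ifs <;> first | ring1 | grind

theorem pderiv_pderiv_comm (hf : ContDiff ℝ ∞ f) (i j : Fin n)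
    (x : EuclideanSpace ℝ (Fin n)) : pderiv i (pderiv j f) x = pderiv j (pderiv i f) x := by
  have hd : DifferentiableAt ℝ (fderiv ℝ f) x :=
    ((hf.fderiv_right (m := ∞) (by simp)).differentiable (by simp)).differentiableAt
  have h : ∀ a b : Fin n, pderiv a (pderiv b f) x =
      fderiv ℝ (fderiv ℝ f) x (coordVec a) (coordVec b) := by
    intro a b
    have := (hd.hasFDerivAt.clm_apply (hasFDerivAt_const (coordVec b) x)).fderiv
    unfold pderiv
    rw [this]
    simp
  rw [h, h]
  have hs : IsSymmSndFDerivAt ℝ f x := hf.contDiffAt.isSymmSndFDerivAt (by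
    simp only [minSmoothness_of_isRCLikeNormedField]; exact WithTop.coe_le_coe.2 le_top)
  exact hs.eq _ _

/-- The coefficients of `Hess f - df ⊗ df + ½|df|² eucl`, the negative of the conformal Schouten-type
tensor of `e^{2f} eucl`. -/
noncomputable def schouten (f : EuclideanSpace ℝ (Fin n) → ℝ) (x : EuclideanSpace ℝ (Fin n))
    (i k : Fin n) : ℝ :=
  pderiv i (pderiv k f) x - pderiv i f x * pderiv k f x
    + if i = k then (∑ m, pderiv m f x ^ 2) / 2 else 0

/-- A conformally flat metric has no Weyl part, so its curvature is algebraic in the Euclidean form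
and `schouten`. -/
theorem Metric.IsConformal.curvComp (hg : g.IsConformal f) (hf : ContDiff ℝ ∞ f)
    (l i j k : Fin n) (x : EuclideanSpace ℝ (Fin n)) :
    g.curvComp l i j k x = (if j = l then schouten f x i k else 0)
      - (if j = k then schouten f x i l else 0) - (if i = l then schouten f x j k else 0)
      + (if i = k then schouten f x j l else 0) := by
  have h1 := sum_christoffel_mul (fun m => pderiv m f x) l i j k
  have h2 := sum_christoffel_mul (fun m => pderiv m f x) l j i k
  rw [Metric.curvComp, Finset.sum_sub_distrib]
  simp only [hg.christoffel hf, hg.pderiv_christoffel hf]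
  rw [h1, h2, pderiv_pderiv_comm hf j i]
  simp only [schouten]
  generalize (∑ m, pderiv m f x ^ 2) = N
  by_cases hil : i = l <;> by_cases hjl : j = l <;> by_cases hik : i = k <;>
    by_cases hjk : j = k <;> grind

theorem sum_sum_ite_left {A : Fin n → Fin n → ℝ} (l : Fin n) :
    ∑ j, ∑ k, (if j = l then A j k else 0) = ∑ k, A l k := by
  rw [Finset.sum_comm]
  simp

theorem Metric.IsConformal.curv_apply (hg : g.IsConformal f) (hf : ContDiff ℝ ∞ f)
    (x u v : EuclideanSpace ℝ (Fin n)) (l : Fin n) :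
    g.curv x u v v l = v l * (∑ i, ∑ k, schouten f x i k * u i * v k)
      - (∑ k, v k * v k) * (∑ i, schouten f x i l * u i)
      - u l * (∑ j, ∑ k, schouten f x j k * v j * v k)
      + (∑ k, u k * v k) * (∑ j, schouten f x j l * v j) := by
  simp only [Metric.curv, hg.curvComp hf]
  generalize schouten f x = S
  simp only [add_mul, sub_mul, ite_mul, zero_mul, Finset.sum_add_distrib, Finset.sum_sub_distrib]
  congr 1
  · congr 1
    · congr 1
      · simp only [sum_sum_ite_left, Finset.mul_sum]
        exact Finset.sum_congr rfl fun i _ => Finset.sum_congr rfl fun k _ => by ring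
      · simp only [Finset.sum_ite_eq, Finset.mem_univ, if_true]
        rw [Finset.sum_comm, Finset.sum_mul]
        simp only [Finset.mul_sum]
        exact Finset.sum_congr rfl fun i _ => Finset.sum_congr rfl fun k _ => by ring
    · rw [Finset.sum_eq_single l]
      · simp only [if_true, Finset.mul_sum]
        exact Finset.sum_congr rfl fun i _ => Finset.sum_congr rfl fun k _ => by ring
      · intro i _ hi
        simp [hi]
      · simp
  · simp only [Finset.sum_ite_eq, Finset.mem_univ, if_true, Finset.sum_mul, Finset.mul_sum]
    rw [Finset.sum_comm]
    exact Finset.sum_congr rfl fun i _ => Finset.sum_congr rfl fun k _ => by ring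

/-- `R(u, v)v` when the Schouten tensor has a radial form. -/
theorem Metric.IsConformal.curv_of_schouten_eq (hg : g.IsConformal f) (hf : ContDiff ℝ ∞ f)
    {x y : EuclideanSpace ℝ (Fin n)} {α β : ℝ}
    (hS : ∀ i k, schouten f x i k = (if i = k then α else 0) + β * y i * y k)
    (u v : EuclideanSpace ℝ (Fin n)) :
    g.curv x u v v = (2 * α * inner ℝ u v + β * inner ℝ y u * inner ℝ y v) • v
      - (2 * α * inner ℝ v v + β * inner ℝ y v ^ 2) • u
      - (β * (inner ℝ v v * inner ℝ y u - inner ℝ u v * inner ℝ y v)) • y := by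
  have hin : ∀ a b : EuclideanSpace ℝ (Fin n), inner ℝ a b = ∑ k, a k * b k := by
    intro a b
    simp [PiLp.inner_apply, mul_comm]
  have hB : ∀ a b : EuclideanSpace ℝ (Fin n), ∑ i, ∑ k, schouten f x i k * a i * b k =
      α * inner ℝ a b + β * inner ℝ y a * inner ℝ y b := by
    intro a b
    simp only [hS, add_mul, ite_mul, zero_mul, Finset.sum_add_distrib, Finset.sum_ite_eq,
      Finset.mem_univ, if_true, hin, Finset.mul_sum, Finset.sum_mul]
    congr 1
    · exact Finset.sum_congr rfl fun i _ => by ring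
    · rw [Finset.sum_comm]
      exact Finset.sum_congr rfl fun i _ => Finset.sum_congr rfl fun k _ => by ring
  have hB1 : ∀ (a : EuclideanSpace ℝ (Fin n)) (l : Fin n), ∑ i, schouten f x i l * a i =
      α * a l + β * inner ℝ y a * y l := by
    intro a l
    simp only [hS, add_mul, ite_mul, zero_mul, Finset.sum_add_distrib, Finset.sum_ite_eq',
      Finset.mem_univ, if_true, hin, Finset.mul_sum, Finset.sum_mul]
    congr 1
    exact Finset.sum_congr rfl fun i _ => by ring
  ext l
  rw [hg.curv_apply hf, hB, hB, hB1, hB1, ← hin, ← hin]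
  simp only [PiLp.sub_apply, PiLp.smul_apply, smul_eq_mul]
  ring

/-- Lower bound for the sectional curvature of a conformal metric with radial Schouten tensor. -/
theorem Metric.IsConformal.neg_le_sec (hg : g.IsConformal f) (hf : ContDiff ℝ ∞ f)
    {x y : EuclideanSpace ℝ (Fin n)} {α β m : ℝ}
    (hS : ∀ i k, schouten f x i k = (if i = k then α else 0) + β * y i * y k)
    (hα : α ≤ 0) (hm : 0 ≤ m) (hβ : 2 * α + β * ‖y‖ ^ 2 ≤ m)
    {u v : EuclideanSpace ℝ (Fin n)} (huv : LinearIndependent ℝ ![u, v]) :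
    -(m * Real.exp (-(2 * f x))) ≤ g.sec x u v := by
  have hvu : inner ℝ v u = inner ℝ u v := real_inner_comm _ _
  have huy : inner ℝ u y = inner ℝ y u := real_inner_comm _ _
  have hvy : inner ℝ v y = inner ℝ y v := real_inner_comm _ _
  have hcurv : inner ℝ (g.curv x u v v) u =
      2 * α * inner ℝ u v ^ 2 + 2 * (β * inner ℝ y u * inner ℝ y v * inner ℝ u v)
      - (2 * α * inner ℝ v v + β * inner ℝ y v ^ 2) * inner ℝ u u
      - β * inner ℝ v v * inner ℝ y u ^ 2 := by
    rw [hg.curv_of_schouten_eq hf hS]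
    simp only [inner_sub_left, inner_smul_left, conj_trivial, hvu]
    ring
  have hv : v ≠ 0 := by simpa using huv.ne_zero 1
  have hvv : 0 < inner ℝ v v := real_inner_self_pos.2 hv
  have hG : 0 < inner ℝ u u * inner ℝ v v - inner ℝ u v ^ 2 := by
    -- This vector is `⟨v, v⟩` times the component of `u` orthogonal to `v`.
    have hw : inner ℝ v v • u - inner ℝ u v • v ≠ 0 := by
      intro h
      have := LinearIndependent.pair_iff.1 huv (inner ℝ v v) (-inner ℝ u v)
        (by rw [neg_smul, ← sub_eq_add_neg]; exact h)
      exact hvv.ne' this.1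
    have hp := real_inner_self_pos.2 hw
    simp only [inner_sub_left, inner_sub_right, inner_smul_left, inner_smul_right, hvu,
      conj_trivial] at hp
    refine pos_of_mul_pos_right (a := inner ℝ v v) ?_ hvv.le
    linarith
  have hQ : 0 ≤ inner ℝ v v * inner ℝ y u ^ 2 + inner ℝ u u * inner ℝ y v ^ 2
      - 2 * inner ℝ u v * inner ℝ y u * inner ℝ y v := by
    have hp : 0 ≤ inner ℝ (inner ℝ y u • v - inner ℝ y v • u)
      (inner ℝ y u • v - inner ℝ y v • u) := real_inner_self_nonneg
    simp only [inner_sub_left, inner_sub_right, inner_smul_left, inner_smul_right, hvu,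
      conj_trivial] at hp
    linarith
  have hQG : inner ℝ v v * inner ℝ y u ^ 2 + inner ℝ u u * inner ℝ y v ^ 2
      - 2 * inner ℝ u v * inner ℝ y u * inner ℝ y v ≤
      ‖y‖ ^ 2 * (inner ℝ u u * inner ℝ v v - inner ℝ u v ^ 2) := by
    rw [← real_inner_self_eq_norm_sq]
    -- Bessel's inequality: with `G` the Gram determinant of `u, v`, this vector is `G` times the
    -- component of `y` orthogonal to the span of `u, v`.
    have hp : 0 ≤ inner ℝ ((inner ℝ u u * inner ℝ v v - inner ℝ u v ^ 2) • y
        - (inner ℝ y u * inner ℝ v v - inner ℝ y v * inner ℝ u v) • u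
        - (inner ℝ y v * inner ℝ u u - inner ℝ y u * inner ℝ u v) • v)
      ((inner ℝ u u * inner ℝ v v - inner ℝ u v ^ 2) • y
        - (inner ℝ y u * inner ℝ v v - inner ℝ y v * inner ℝ u v) • u
        - (inner ℝ y v * inner ℝ u u - inner ℝ y u * inner ℝ u v) • v) := real_inner_self_nonneg
    simp only [inner_sub_left, inner_sub_right, inner_smul_left, inner_smul_right, hvu, huy, hvy,
      conj_trivial] at hp
    rw [← sub_nonneg]
    refine nonneg_of_mul_nonneg_right (a := inner ℝ u u * inner ℝ v v - inner ℝ u v ^ 2) ?_ hG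
    refine hp.trans_eq ?_
    ring
  have hbound : 2 * α * (inner ℝ u u * inner ℝ v v - inner ℝ u v ^ 2)
      + β * (inner ℝ v v * inner ℝ y u ^ 2 + inner ℝ u u * inner ℝ y v ^ 2
      - 2 * inner ℝ u v * inner ℝ y u * inner ℝ y v) ≤
      m * (inner ℝ u u * inner ℝ v v - inner ℝ u v ^ 2) := by
    -- The expression divided by `G` is `2α + βτ`, where `τ ∈ [0, ‖y‖²]` is the squared length of
    -- the projection of `y` to the plane. It is affine in `τ`, so the worst endpoint depends on the
    -- sign of `β`.
    rcases le_total 0 β with h | h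
    · calc _ ≤ 2 * α * (inner ℝ u u * inner ℝ v v - inner ℝ u v ^ 2)
            + β * (‖y‖ ^ 2 * (inner ℝ u u * inner ℝ v v - inner ℝ u v ^ 2)) := by gcongr
        _ = (2 * α + β * ‖y‖ ^ 2) * (inner ℝ u u * inner ℝ v v - inner ℝ u v ^ 2) := by ring
        _ ≤ _ := by gcongr
    · have h1 := mul_nonpos_of_nonpos_of_nonneg h hQ
      have h2 := mul_nonpos_of_nonpos_of_nonneg hα hG.le
      have h3 := mul_nonneg hm hG.le
      linarith
  have hE : 0 < Real.exp (2 * f x) := Real.exp_pos _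
  rw [Metric.sec, hg, hg, hg, hg, hcurv, le_div_iff₀ (by
    have := mul_pos (mul_pos hE hE) hG
    linarith), Real.exp_neg]
  have : -(m * (Real.exp (2 * f x))⁻¹) * (Real.exp (2 * f x) * inner ℝ u u *
      (Real.exp (2 * f x) * inner ℝ v v) - (Real.exp (2 * f x) * inner ℝ u v) ^ 2) =
      Real.exp (2 * f x) * -(m * (inner ℝ u u * inner ℝ v v - inner ℝ u v ^ 2)) := by
    field_simp
  rw [this]
  refine mul_le_mul_of_nonneg_left ?_ hE.le
  linarith

end ConformalCurvature

end RiemannRn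

/-! ### The one-variable transition profile. -/

namespace RiemannRn

open MeasureTheory Set

section Profile

/-- A smooth convex function with slope `-1` on `(-∞, 0]` that vanishes on `[1, ∞)`. -/
noncomputable def profile (s : ℝ) : ℝ := ∫ r in s..1, Real.smoothTransition (1 - r)

theorem hasDerivAt_profile (s : ℝ) : HasDerivAt profile (-Real.smoothTransition (1 - s)) s := by
  have hc : Continuous fun r : ℝ => Real.smoothTransition (1 - r) := by fun_prop
  exact intervalIntegral.integral_hasDerivAt_left (hc.intervalIntegrable _ _)
    (hc.stronglyMeasurableAtFilter _ _) hc.continuousAt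

theorem deriv_profile : deriv profile = fun s => -Real.smoothTransition (1 - s) :=
  funext fun s => (hasDerivAt_profile s).deriv

theorem contDiff_profile : ContDiff ℝ ∞ profile := by
  rw [contDiff_infty_iff_deriv]
  refine ⟨fun s => (hasDerivAt_profile s).differentiableAt, ?_⟩
  rw [deriv_profile]
  exact (Real.smoothTransition.contDiff.comp (contDiff_const.sub contDiff_id)).neg

theorem antitone_profile : Antitone profile := by
  refine antitone_of_deriv_nonpos (contDiff_profile.differentiable (by simp)) fun s => ?_
  rw [deriv_profile]
  simpa using Real.smoothTransition.nonneg (1 - s)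

theorem profile_of_one_le {s : ℝ} (hs : 1 ≤ s) : profile s = 0 := by
  unfold profile
  rw [intervalIntegral.integral_congr (g := fun _ => (0 : ℝ))]
  · simp
  · intro r hr
    rw [uIcc_of_ge hs] at hr
    exact Real.smoothTransition.zero_of_nonpos (by linarith [hr.1])

theorem profile_nonneg (s : ℝ) : 0 ≤ profile s := by
  rcases le_total s 1 with h | h
  · rw [← profile_of_one_le le_rfl]
    exact antitone_profile h
  · rw [profile_of_one_le h]

theorem profile_of_nonpos {s : ℝ} (hs : s ≤ 0) : profile s = profile 0 - s := by
  have hc : Continuous fun r : ℝ => Real.smoothTransition (1 - r) := by fun_prop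
  have h1 : profile s = (∫ r in s..0, Real.smoothTransition (1 - r)) + profile 0 :=
    (intervalIntegral.integral_add_adjacent_intervals (hc.intervalIntegrable _ _)
      (hc.intervalIntegrable _ _)).symm
  rw [h1, intervalIntegral.integral_congr (g := fun _ => (1 : ℝ))]
  · simp
    ring
  · intro r hr
    rw [uIcc_of_le hs] at hr
    exact Real.smoothTransition.one_of_one_le (by linarith [hr.2])

theorem profile_le_one_sub {s : ℝ} (hs : s ≤ 1) : profile s ≤ 1 - s := by
  have hc : Continuous fun r : ℝ => Real.smoothTransition (1 - r) := by fun_prop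
  calc profile s ≤ ∫ _ in s..1, (1 : ℝ) :=
        intervalIntegral.integral_mono_on hs (hc.intervalIntegrable _ _)
          intervalIntegrable_const fun _ _ => Real.smoothTransition.le_one _
    _ = 1 - s := by simp

/-- The second derivative of `profile`. -/
noncomputable def profileCurv (s : ℝ) : ℝ := deriv Real.smoothTransition (1 - s)

theorem hasDerivAt_neg_smoothTransition (s : ℝ) :
    HasDerivAt (fun s => -Real.smoothTransition (1 - s)) (profileCurv s) s := by
  have h : HasDerivAt Real.smoothTransition (deriv Real.smoothTransition (1 - s)) (1 - s) :=
    ((Real.smoothTransition.contDiff (n := 1)).differentiable (by simp)).differentiableAt.hasDerivAt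
  have := (h.comp s ((hasDerivAt_id s).const_sub 1)).neg
  exact this.congr_deriv (by rw [profileCurv]; ring)

theorem profileCurv_nonneg (s : ℝ) : 0 ≤ profileCurv s :=
  Real.smoothTransition.monotone.deriv_nonneg

theorem profileCurv_eq_zero {s : ℝ} (hs : s < 0 ∨ 1 < s) : profileCurv s = 0 := by
  unfold profileCurv
  rcases hs with h | h
  · have : Real.smoothTransition =ᶠ[nhds (1 - s)] fun _ => 1 := by
      filter_upwards [Ioi_mem_nhds (show 1 < 1 - s by linarith)] with r hr
      exact Real.smoothTransition.one_of_one_le (le_of_lt hr)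
    rw [this.deriv_eq, deriv_const]
  · have : Real.smoothTransition =ᶠ[nhds (1 - s)] fun _ => 0 := by
      filter_upwards [Iio_mem_nhds (show 1 - s < 0 by linarith)] with r hr
      exact Real.smoothTransition.zero_of_nonpos (le_of_lt hr)
    rw [this.deriv_eq, deriv_const]

theorem continuous_profileCurv : Continuous profileCurv :=
  ((Real.smoothTransition.contDiff (n := 1)).continuous_deriv le_rfl).comp
    (continuous_const.sub continuous_id)

theorem exists_profileCurv_le : ∃ C : ℝ, 0 < C ∧ ∀ s, profileCurv s ≤ C := by
  obtain ⟨C, hC⟩ := isCompact_Icc.exists_bound_of_continuousOn (s := Icc (0 : ℝ) 1)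
    continuous_profileCurv.continuousOn
  refine ⟨max C 1, by positivity, fun s => ?_⟩
  by_cases hs : s ∈ Icc (0 : ℝ) 1
  · exact (le_abs_self _).trans ((hC s hs).trans (le_max_left _ _))
  · rw [profileCurv_eq_zero]
    · positivity
    · by_contra! h
      exact hs h

end Profile

/-! ### The Schouten tensor of a radial function. -/

section Radial

variable {n : ℕ} {f : EuclideanSpace ℝ (Fin n) → ℝ}

theorem pderiv_norm_sub_sq (c x : EuclideanSpace ℝ (Fin n)) (i : Fin n) {Φ : ℝ → ℝ} {a : ℝ}
    (h : HasDerivAt Φ a (‖x - c‖ ^ 2)) :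
    HasFDerivAt (fun z => Φ (‖z - c‖ ^ 2)) (a • (2 : ℝ) • innerSL ℝ (x - c)) x ∧
    pderiv i (fun z => Φ (‖z - c‖ ^ 2)) x = a * (2 * (x - c) i) := by
  have h1 : HasFDerivAt (fun z : EuclideanSpace ℝ (Fin n) => ‖z - c‖ ^ 2)
      ((2 : ℝ) • innerSL ℝ (x - c)) x := by
    have := ((hasFDerivAt_id x).sub_const c).norm_sq
    refine this.congr_fderiv ?_
    ext v
    simp
  have h2 := h.comp_hasFDerivAt x h1
  refine ⟨h2, ?_⟩
  unfold pderiv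
  have h3 : fderiv ℝ (fun z => Φ (‖z - c‖ ^ 2)) x = a • (2 : ℝ) • innerSL ℝ (x - c) := h2.fderiv
  rw [h3]
  simp [coordVec, EuclideanSpace.inner_single_right]

/-- Only the germ of `f` at `x` matters, which is what allows different bubbles to be treated
separately. -/
theorem schouten_of_eventuallyEq_radial {c x : EuclideanSpace ℝ (Fin n)} {Φ Φ₁ : ℝ → ℝ} {a : ℝ}
    (hf : f =ᶠ[nhds x] fun z => Φ (‖z - c‖ ^ 2)) (h1 : ∀ q, 0 ≤ q → HasDerivAt Φ (Φ₁ q) q)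
    (h2 : HasDerivAt Φ₁ a (‖x - c‖ ^ 2)) (i k : Fin n) :
    schouten f x i k =
      (if i = k then 2 * Φ₁ (‖x - c‖ ^ 2) * (1 + ‖x - c‖ ^ 2 * Φ₁ (‖x - c‖ ^ 2)) else 0)
      + (4 * a - 4 * Φ₁ (‖x - c‖ ^ 2) ^ 2) * (x - c) i * (x - c) k := by
  have hp : ∀ j, pderiv j f =ᶠ[nhds x] fun z => Φ₁ (‖z - c‖ ^ 2) * (2 * (z - c) j) := by
    intro j
    filter_upwards [hf.eventuallyEq_nhds] with z hz
    rw [← (pderiv_norm_sub_sq c z j (h1 _ (sq_nonneg _))).2]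
    unfold pderiv
    rw [hz.fderiv_eq]
  have hpp : pderiv i (pderiv k f) x = a * (2 * (x - c) i) * (2 * (x - c) k)
      + Φ₁ (‖x - c‖ ^ 2) * (2 * if i = k then 1 else 0) := by
    have h3 : HasFDerivAt (fun z : EuclideanSpace ℝ (Fin n) => 2 * (z - c) k)
        ((2 : ℝ) • (EuclideanSpace.proj k : EuclideanSpace ℝ (Fin n) →L[ℝ] ℝ)) x := by
      have : HasFDerivAt (fun z : EuclideanSpace ℝ (Fin n) => (z - c) k)
          (EuclideanSpace.proj k : EuclideanSpace ℝ (Fin n) →L[ℝ] ℝ) x := by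
        have := (EuclideanSpace.proj k : EuclideanSpace ℝ (Fin n) →L[ℝ] ℝ).hasFDerivAt.comp x
          ((hasFDerivAt_id x).sub_const c)
        exact this
      exact this.const_mul 2
    have h4 := ((pderiv_norm_sub_sq c x i h2).1.mul h3).fderiv
    have h5 : fderiv ℝ (pderiv k f) x = _ := (hp k).fderiv_eq.trans h4
    change fderiv ℝ (pderiv k f) x (coordVec i) = _
    rw [h5]
    simp [coordVec, EuclideanSpace.inner_single_right, eq_comm]
    ring
  have hN : ∑ m, pderiv m f x ^ 2 = 4 * Φ₁ (‖x - c‖ ^ 2) ^ 2 * ‖x - c‖ ^ 2 := by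
    simp only [fun m => (hp m).eq_of_nhds]
    rw [EuclideanSpace.norm_sq_eq, Finset.mul_sum]
    refine Finset.sum_congr rfl fun m _ => ?_
    rw [Real.norm_eq_abs, sq_abs]
    ring
  rw [schouten, hpp, (hp i).eq_of_nhds, (hp k).eq_of_nhds, hN]
  split_ifs <;> ring

end Radial

end RiemannRn

/-! ### A single bubble: conformal factor and curvature. -/

namespace RiemannRn

open MeasureTheory Set

section Bubble

/-- The conformal exponent of a bubble, as a function of the squared Euclidean distance to its
centre: a large round sphere of conformal radius `b` attached to the flat space through a neck of
conformal length `T`, at the scale `1 / l`. -/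
noncomputable def bubble (T l b q : ℝ) : ℝ := T * profile (Real.log (l ^ 2 * (b ^ 2 + q)) / T)

/-- The derivative of `bubble`. -/
noncomputable def bubbleDeriv (T l b q : ℝ) : ℝ :=
  -Real.smoothTransition (1 - Real.log (l ^ 2 * (b ^ 2 + q)) / T) / (b ^ 2 + q)

/-- A bound for the negative part of the sectional curvatures of a bubble, up to conformal
scaling. -/
noncomputable def bubbleDefect (T l b q : ℝ) : ℝ :=
  4 * profileCurv (Real.log (l ^ 2 * (b ^ 2 + q)) / T) / (T * (b ^ 2 + q))

variable {T l b : ℝ}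

theorem hasDerivAt_log_bubble (hl : 0 < l) (hb : 0 < b) {q : ℝ} (hq : 0 ≤ q) :
    HasDerivAt (fun q => Real.log (l ^ 2 * (b ^ 2 + q)) / T) (1 / (T * (b ^ 2 + q))) q := by
  have hw : 0 < b ^ 2 + q := by positivity
  have h := ((((hasDerivAt_id q).const_add (b ^ 2)).const_mul (l ^ 2)).log
    (by simp only [id]; positivity)).div_const T
  exact h.congr_deriv (by simp only [id]; field_simp)

theorem hasDerivAt_bubble (hT : 0 < T) (hl : 0 < l) (hb : 0 < b) {q : ℝ} (hq : 0 ≤ q) :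
    HasDerivAt (bubble T l b) (bubbleDeriv T l b q) q := by
  have hw : 0 < b ^ 2 + q := by positivity
  have h := ((hasDerivAt_profile _).comp q (hasDerivAt_log_bubble (T := T) hl hb hq)).const_mul T
  exact h.congr_deriv (by simp only [bubbleDeriv]; field_simp)

theorem hasDerivAt_bubbleDeriv (hT : 0 < T) (hl : 0 < l) (hb : 0 < b) {q : ℝ} (hq : 0 ≤ q) :
    HasDerivAt (bubbleDeriv T l b)
      (bubbleDefect T l b q / (4 * (b ^ 2 + q)) - bubbleDeriv T l b q / (b ^ 2 + q)) q := by
  have hw : 0 < b ^ 2 + q := by positivity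
  have h := ((hasDerivAt_neg_smoothTransition _).comp q
    (hasDerivAt_log_bubble (T := T) hl hb hq)).div ((hasDerivAt_id q).const_add (b ^ 2)) hw.ne'
  exact h.congr_deriv (by simp only [bubbleDeriv, bubbleDefect, id, Function.comp]; field_simp)

theorem contDiff_bubble {n : ℕ} (hl : 0 < l) (hb : 0 < b) (c : EuclideanSpace ℝ (Fin n)) :
    ContDiff ℝ ∞ fun x => bubble T l b (‖x - c‖ ^ 2) := by
  refine contDiff_const.mul (contDiff_profile.comp (ContDiff.div_const (ContDiff.log ?_ ?_) T))
  · exact contDiff_const.mul (contDiff_const.add ((contDiff_id.sub contDiff_const).norm_sq ℝ))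
  · intro x
    positivity

theorem bubble_nonneg (hT : 0 < T) (q : ℝ) : 0 ≤ bubble T l b q :=
  mul_nonneg hT.le (profile_nonneg _)

theorem bubble_eq_zero (hT : 0 < T) {q : ℝ} (hw : Real.exp T ≤ l ^ 2 * (b ^ 2 + q)) :
    bubble T l b q = 0 := by
  rw [bubble, profile_of_one_le, mul_zero]
  rw [one_le_div hT]
  exact (Real.le_log_iff_exp_le ((Real.exp_pos T).trans_le hw)).2 hw

/-- Here the profile is affine with slope `-1`, so the factor is that of a round sphere in
stereographic coordinates. -/
theorem exp_bubble_of_le_one (hT : 0 < T) (hl : 0 < l) (hb : 0 < b) {q : ℝ} (hq : 0 ≤ q)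
    (hw : l ^ 2 * (b ^ 2 + q) ≤ 1) :
    Real.exp (bubble T l b q) = Real.exp (T * profile 0) / (l ^ 2 * (b ^ 2 + q)) := by
  have hw0 : 0 < l ^ 2 * (b ^ 2 + q) := by positivity
  rw [bubble, profile_of_nonpos (div_nonpos_of_nonpos_of_nonneg
    (Real.log_nonpos hw0.le hw) hT.le), mul_sub, mul_div_cancel₀ _ hT.ne', Real.exp_sub,
    Real.exp_log hw0]

/-- The three summands dominate the flat, spherical and neck regions. The `1 +` in the last
denominator makes it a Lorentzian of width `1 / l` along lines, whatever the core radius `b`. -/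
theorem exp_bubble_le (hT : 0 < T) (hl : 0 < l) (hb : 0 < b) {q : ℝ} (hq : 0 ≤ q) :
    Real.exp (bubble T l b q) ≤ 1 + Real.exp (T * profile 0) / (l ^ 2 * (b ^ 2 + q))
      + 2 * Real.exp T / (1 + l ^ 2 * (b ^ 2 + q)) := by
  have hw0 : 0 < l ^ 2 * (b ^ 2 + q) := by positivity
  rcases le_total (l ^ 2 * (b ^ 2 + q)) 1 with hw | hw
  · rw [exp_bubble_of_le_one hT hl hb hq hw]
    have : 0 ≤ 2 * Real.exp T / (1 + l ^ 2 * (b ^ 2 + q)) := by positivity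
    linarith
  · have h1 : 0 ≤ Real.exp (T * profile 0) / (l ^ 2 * (b ^ 2 + q)) := by positivity
    rcases le_total (Real.exp T) (l ^ 2 * (b ^ 2 + q)) with h | h
    · rw [bubble_eq_zero hT h, Real.exp_zero]
      have : 0 ≤ 2 * Real.exp T / (1 + l ^ 2 * (b ^ 2 + q)) := by positivity
      linarith
    · have h2 : Real.exp (bubble T l b q) ≤ Real.exp T / (l ^ 2 * (b ^ 2 + q)) := by
        have hs : Real.log (l ^ 2 * (b ^ 2 + q)) / T ≤ 1 := by
          rw [div_le_one hT]
          exact (Real.log_le_iff_le_exp hw0).2 h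
        have : bubble T l b q ≤ T - Real.log (l ^ 2 * (b ^ 2 + q)) := by
          calc bubble T l b q ≤ T * (1 - Real.log (l ^ 2 * (b ^ 2 + q)) / T) :=
                mul_le_mul_of_nonneg_left (profile_le_one_sub hs) hT.le
            _ = _ := by field_simp
        refine (Real.exp_le_exp.2 this).trans_eq ?_
        rw [Real.exp_sub, Real.exp_log hw0]
      have h3 : Real.exp T / (l ^ 2 * (b ^ 2 + q)) ≤
          2 * Real.exp T / (1 + l ^ 2 * (b ^ 2 + q)) := by
        rw [div_le_div_iff₀ hw0 (by positivity)]
        nlinarith [Real.exp_pos T]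
      linarith

theorem bubbleDefect_nonneg (hT : 0 < T) (hb : 0 < b) {q : ℝ} (hq : 0 ≤ q) :
    0 ≤ bubbleDefect T l b q := by
  have := profileCurv_nonneg (Real.log (l ^ 2 * (b ^ 2 + q)) / T)
  unfold bubbleDefect
  positivity

theorem one_le_of_bubbleDefect_ne_zero (hT : 0 < T) (hl : 0 < l) (hb : 0 < b) {q : ℝ}
    (hq : 0 ≤ q) (h : bubbleDefect T l b q ≠ 0) :
    1 ≤ l ^ 2 * (b ^ 2 + q) ∧ Real.log (l ^ 2 * (b ^ 2 + q)) ≤ T := by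
  have hw0 : 0 < l ^ 2 * (b ^ 2 + q) := by positivity
  have h1 : ¬ (Real.log (l ^ 2 * (b ^ 2 + q)) / T < 0 ∨
      1 < Real.log (l ^ 2 * (b ^ 2 + q)) / T) := by
    intro hs
    apply h
    simp [bubbleDefect, profileCurv_eq_zero hs]
  push Not at h1
  constructor
  · rw [← Real.log_nonneg_iff hw0]
    have := mul_nonneg h1.1 hT.le
    rwa [div_mul_cancel₀ _ hT.ne'] at this
  · have := h1.2
    rwa [div_le_one hT] at this

theorem bubbleDefect_le_div (hT : 0 < T) (hl : 0 < l) (hb : 0 < b) {C : ℝ}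
    (hC : ∀ s, profileCurv s ≤ C) {q : ℝ} (hq : 0 ≤ q) :
    bubbleDefect T l b q ≤ 4 * C * l ^ 2 / (T * (l ^ 2 * (b ^ 2 + q))) := by
  have hw : 0 < b ^ 2 + q := by positivity
  have : 4 * C * l ^ 2 / (T * (l ^ 2 * (b ^ 2 + q))) = 4 * C / (T * (b ^ 2 + q)) := by
    field_simp
  rw [this, bubbleDefect]
  gcongr
  exact hC _

/-- The defect lives where `l² (b² + q) ≥ 1`, so the bound does not involve `b`: this is the source
of the uniform lower curvature bound. -/
theorem bubbleDefect_le (hT : 0 < T) (hl : 0 < l) (hb : 0 < b) {C : ℝ} (hC0 : 0 ≤ C)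
    (hC : ∀ s, profileCurv s ≤ C) {q : ℝ} (hq : 0 ≤ q) :
    bubbleDefect T l b q ≤ 4 * C * l ^ 2 / T := by
  by_cases h : bubbleDefect T l b q = 0
  · rw [h]
    positivity
  · refine (bubbleDefect_le_div hT hl hb hC hq).trans ?_
    have := (one_le_of_bubbleDefect_ne_zero hT hl hb hq h).1
    gcongr
    exact le_mul_of_one_le_right hT.le this

/-- The sectional curvatures of a bubble. -/
theorem Metric.IsConformal.neg_bubbleDefect_le_sec {n : ℕ} {f : EuclideanSpace ℝ (Fin n) → ℝ}
    {g : Metric n} (hg : g.IsConformal f) (hf : ContDiff ℝ ∞ f) (hT : 0 < T) (hl : 0 < l)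
    (hb : 0 < b) {c x : EuclideanSpace ℝ (Fin n)}
    (hfx : f =ᶠ[nhds x] fun z => bubble T l b (‖z - c‖ ^ 2))
    {u v : EuclideanSpace ℝ (Fin n)} (huv : LinearIndependent ℝ ![u, v]) :
    -(bubbleDefect T l b (‖x - c‖ ^ 2) * Real.exp (-(2 * f x))) ≤ g.sec x u v := by
  have hq : 0 ≤ ‖x - c‖ ^ 2 := sq_nonneg _
  have hw : 0 < b ^ 2 + ‖x - c‖ ^ 2 := by positivity
  refine hg.neg_le_sec hf (y := x - c)
    (schouten_of_eventuallyEq_radial hfx (fun q hq => hasDerivAt_bubble hT hl hb hq)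
      (hasDerivAt_bubbleDeriv hT hl hb hq)) ?_ (bubbleDefect_nonneg hT hb hq) ?_ huv
  · have h1 : bubbleDeriv T l b (‖x - c‖ ^ 2) ≤ 0 := by
      refine div_nonpos_of_nonpos_of_nonneg ?_ hw.le
      simpa using Real.smoothTransition.nonneg _
    -- The slope is at least `-1 / (b² + q)`, so `α = 2p(1 + qp)` has the sign of `p`, or vanishes.
    have h2 : -1 ≤ ‖x - c‖ ^ 2 * bubbleDeriv T l b (‖x - c‖ ^ 2) := by
      rw [bubbleDeriv, ← mul_div_assoc, le_div_iff₀ hw]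
      have h3 := Real.smoothTransition.le_one (1 - Real.log (l ^ 2 * (b ^ 2 + ‖x - c‖ ^ 2)) / T)
      nlinarith [sq_nonneg b]
    nlinarith
  · have h1 : bubbleDeriv T l b (‖x - c‖ ^ 2) ≤ 0 := by
      refine div_nonpos_of_nonpos_of_nonneg ?_ hw.le
      simpa using Real.smoothTransition.nonneg _
    have hD := bubbleDefect_nonneg (l := l) hT hb hq
    generalize bubbleDefect T l b (‖x - c‖ ^ 2) = D at *
    generalize bubbleDeriv T l b (‖x - c‖ ^ 2) = p at *
    generalize ‖x - c‖ ^ 2 = q at *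
    -- The terms in `p²` cancel, and what is left of the linear term, `4 p b²`, is nonpositive.
    have h2 : 2 * (2 * p * (1 + q * p)) + (4 * (D / (4 * (b ^ 2 + q)) - p / (b ^ 2 + q)) -
        4 * p ^ 2) * q = (4 * p * b ^ 2 + D * q) / (b ^ 2 + q) := by
      field_simp
      ring
    rw [h2, div_le_iff₀ hw]
    nlinarith [sq_nonneg b, mul_nonneg hD (sq_nonneg b),
      mul_nonpos_of_nonpos_of_nonneg h1 (sq_nonneg b)]

end Bubble

/-! ### The curvature integral of a single bubble. -/

section Cost

variable {T l b : ℝ}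

/-- Cut the neck into shells `e^m ≤ l² (b² + q) < e^(m+1)`. By scale invariance each has the same
bound, of order `T^(-n/2)`, and at most `⌊T⌋₊ + 1` shells occur. -/
theorem lintegral_bubbleDefect_le {n : ℕ} (hn : 0 < n) (hT : 1 / 4 ≤ T) (hl : 0 < l) (hb : 0 < b)
    {C : ℝ} (hC0 : 0 ≤ C) (hC : ∀ s, profileCurv s ≤ C) (c : EuclideanSpace ℝ (Fin n)) :
    ∫⁻ x, ENNReal.ofReal (bubbleDefect T l b (‖x - c‖ ^ 2) ^ ((n : ℝ) / 2)) ≤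
      ENNReal.ofReal (5 * (4 * C * Real.exp 1) ^ ((n : ℝ) / 2) * T ^ (1 - (n : ℝ) / 2))
        * volume (_root_.Metric.ball (0 : EuclideanSpace ℝ (Fin n)) 1) := by
  have hT0 : 0 < T := by linarith
  rw [lintegral_sub_right_eq_self
    (fun x => ENNReal.ofReal (bubbleDefect T l b (‖x‖ ^ 2) ^ ((n : ℝ) / 2))) c]
  set M : ℕ := ⌊T⌋₊ + 1 with hM
  set A : ℕ → ℝ := fun m => (4 * C * l ^ 2 / (T * Real.exp m)) ^ ((n : ℝ) / 2) with hA
  set r : ℕ → ℝ := fun m => Real.exp (((m : ℝ) + 1) / 2) / l with hr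
  have hpt : ∀ x : EuclideanSpace ℝ (Fin n),
      ENNReal.ofReal (bubbleDefect T l b (‖x‖ ^ 2) ^ ((n : ℝ) / 2)) ≤
      ∑ m ∈ Finset.range M, (_root_.Metric.ball (0 : EuclideanSpace ℝ (Fin n)) (r m)).indicator
        (fun _ => ENNReal.ofReal (A m)) x := by
    intro x
    have hq : 0 ≤ ‖x‖ ^ 2 := sq_nonneg _
    by_cases h : bubbleDefect T l b (‖x‖ ^ 2) = 0
    · rw [h, Real.zero_rpow (by positivity)]
      simp
    obtain ⟨h1, h2⟩ := one_le_of_bubbleDefect_ne_zero hT0 hl hb hq h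
    have hlog := Real.log_nonneg h1
    have hw0 : 0 < l ^ 2 * (b ^ 2 + ‖x‖ ^ 2) := by linarith
    set m := ⌊Real.log (l ^ 2 * (b ^ 2 + ‖x‖ ^ 2))⌋₊ with hm
    have hm1 : (m : ℝ) ≤ Real.log (l ^ 2 * (b ^ 2 + ‖x‖ ^ 2)) := Nat.floor_le hlog
    have hm2 : Real.log (l ^ 2 * (b ^ 2 + ‖x‖ ^ 2)) < m + 1 := Nat.lt_floor_add_one _
    have hmM : m ∈ Finset.range M := by
      rw [Finset.mem_range, hM, Nat.lt_succ_iff]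
      exact Nat.floor_le_floor h2
    refine le_trans ?_ (Finset.single_le_sum
      (f := fun m => (_root_.Metric.ball (0 : EuclideanSpace ℝ (Fin n)) (r m)).indicator
        (fun _ => ENNReal.ofReal (A m)) x) (fun _ _ => zero_le) hmM)
    have hx : x ∈ _root_.Metric.ball (0 : EuclideanSpace ℝ (Fin n)) (r m) := by
      rw [mem_ball_zero_iff, hr, lt_div_iff₀ hl]
      refine lt_of_pow_lt_pow_left₀ 2 (Real.exp_pos _).le ?_
      rw [← Real.exp_nat_mul]
      have : ((2 : ℕ) : ℝ) * (((m : ℝ) + 1) / 2) = m + 1 := by push_cast; ring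
      rw [this]
      refine lt_of_le_of_lt ?_ ((Real.log_lt_iff_lt_exp hw0).1 hm2)
      nlinarith [sq_nonneg (l * b)]
    rw [indicator_of_mem hx]
    refine ENNReal.ofReal_le_ofReal (Real.rpow_le_rpow (bubbleDefect_nonneg hT0 hb hq) ?_
      (by positivity))
    refine (bubbleDefect_le_div hT0 hl hb hC hq).trans ?_
    gcongr
    exact (Real.le_log_iff_exp_le hw0).1 hm1
  -- Both `l` and `e^m` cancel: this is the scale invariance.
  have hterm : ∀ m, A m * r m ^ n = (4 * C * Real.exp 1) ^ ((n : ℝ) / 2) * T ^ (-((n : ℝ) / 2)) := by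
    intro m
    have hr0 : 0 ≤ r m := by positivity
    have h1 : r m ^ n = (r m ^ 2) ^ ((n : ℝ) / 2) := by
      rw [← Real.rpow_natCast_mul hr0, ← Real.rpow_natCast]
      congr 1
      push_cast
      ring
    have h2 : r m ^ 2 = Real.exp m * Real.exp 1 / l ^ 2 := by
      rw [hr, div_pow, ← Real.exp_nat_mul, ← Real.exp_add]
      congr 2
      push_cast
      ring
    rw [h1, h2, hA, ← Real.mul_rpow (by positivity) (by positivity), Real.rpow_neg hT0.le,
      ← Real.inv_rpow hT0.le, ← Real.mul_rpow (by positivity) (by positivity)]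
    congr 1
    field_simp
  calc ∫⁻ x, ENNReal.ofReal (bubbleDefect T l b (‖x‖ ^ 2) ^ ((n : ℝ) / 2))
      ≤ ∫⁻ x, ∑ m ∈ Finset.range M, (_root_.Metric.ball (0 : EuclideanSpace ℝ (Fin n)) (r m)).indicator
        (fun _ => ENNReal.ofReal (A m)) x := lintegral_mono hpt
    _ = ∑ m ∈ Finset.range M, ENNReal.ofReal (A m) *
        volume (_root_.Metric.ball (0 : EuclideanSpace ℝ (Fin n)) (r m)) := by
        rw [lintegral_finsetSum _ fun m _ => measurable_const.indicator measurableSet_ball]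
        exact Finset.sum_congr rfl fun m _ => lintegral_indicator_const measurableSet_ball _
    _ = ∑ m ∈ Finset.range M, ENNReal.ofReal ((4 * C * Real.exp 1) ^ ((n : ℝ) / 2) *
        T ^ (-((n : ℝ) / 2))) * volume (_root_.Metric.ball (0 : EuclideanSpace ℝ (Fin n)) 1) := by
        refine Finset.sum_congr rfl fun m _ => ?_
        have hr0 : 0 < r m := by positivity
        rw [Measure.addHaar_ball_of_pos volume 0 hr0, finrank_euclideanSpace, Fintype.card_fin,
          ← mul_assoc, ← ENNReal.ofReal_mul (by positivity), hterm]
    _ ≤ _ := by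
        rw [Finset.sum_const, Finset.card_range, nsmul_eq_mul, ← mul_assoc,
          ← ENNReal.ofReal_natCast, ← ENNReal.ofReal_mul (by positivity)]
        refine mul_le_mul_left ?_ _
        refine ENNReal.ofReal_le_ofReal ?_
        -- `T + 1 ≤ 5T` because `T ≥ 1/4`.
        have hM5 : (M : ℝ) ≤ 5 * T := by
          have := Nat.floor_le hT0.le
          rw [hM]
          push_cast
          linarith
        rw [sub_eq_add_neg 1 ((n : ℝ) / 2), Real.rpow_add hT0, Real.rpow_one]
        calc (M : ℝ) * ((4 * C * Real.exp 1) ^ ((n : ℝ) / 2) * T ^ (-((n : ℝ) / 2)))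
            ≤ 5 * T * ((4 * C * Real.exp 1) ^ ((n : ℝ) / 2) * T ^ (-((n : ℝ) / 2))) := by
              gcongr
          _ = _ := by ring

end Cost

end RiemannRn

/-! ### Configurations of disjoint bubbles. -/

namespace RiemannRn

open MeasureTheory Set

/-- Numbers `N k` of bubbles of size `2 ^ k`, together with three coordinate axes and a scale `l`
large enough for the bubbles to be disjoint. -/
structure BubbleConfig (n : ℕ) where
  /-- The axis along which the different sizes are arranged. -/
  i₀ : Fin n
  /-- The axis along which the bubbles of the same size are arranged. -/
  i₁ : Fin n
  /-- The axis along which the bubbles are reached. -/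
  i₂ : Fin n
  ne₀₁ : i₀ ≠ i₁
  ne₀₂ : i₀ ≠ i₂
  ne₁₂ : i₁ ≠ i₂
  /-- The number of bubbles of size `2 ^ k`. -/
  N : ℕ → ℕ
  /-- The inverse of the scale of the narrowest parts. -/
  l : ℝ
  one_le_l : 1 ≤ l
  scale_le : ∀ k : ℕ, 128 * Real.exp (((k : ℝ) + 1) / 4) * ((N k : ℝ) + 1) ≤ l * 2 ^ k

namespace BubbleConfig

variable {n : ℕ} (S : BubbleConfig n)

/-- The conformal length of the necks of the bubbles of size `2 ^ k`. -/
noncomputable def neck (k : ℕ) : ℝ := ((k : ℝ) + 1) / 4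

/-- The Euclidean radius of the bubbles of size `2 ^ k`. -/
noncomputable def radius (k : ℕ) : ℝ := Real.exp (neck k / 2) / S.l

/-- The Euclidean radius of the cores of the bubbles of size `2 ^ k`. -/
noncomputable def core (k : ℕ) : ℝ := 32 * Real.exp (neck k * profile 0) / (S.l ^ 2 * 2 ^ k)

/-- The index type of the bubbles. -/
abbrev Index : Type := Σ k, Fin (S.N k)

/-- The centre of a bubble. -/
noncomputable def center (i : S.Index) : EuclideanSpace ℝ (Fin n) :=
  (2 ^ i.1 / 8 : ℝ) • coordVec S.i₀ + (3 * S.radius i.1 * (i.2 : ℕ) : ℝ) • coordVec S.i₁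

/-- The conformal exponent of a single bubble. -/
noncomputable def single (i : S.Index) (x : EuclideanSpace ℝ (Fin n)) : ℝ :=
  bubble (neck i.1) S.l (S.core i.1) (‖x - S.center i‖ ^ 2)

/-- The conformal exponent of the configuration. -/
noncomputable def exponent (x : EuclideanSpace ℝ (Fin n)) : ℝ := ∑ᶠ i, S.single i x

theorem neck_pos (k : ℕ) : 0 < neck k := by unfold neck; positivity

theorem quarter_le_neck (k : ℕ) : 1 / 4 ≤ neck k := by
  unfold neck
  have : (0 : ℝ) ≤ k := by positivity
  linarith

theorem l_pos : 0 < S.l := zero_lt_one.trans_le S.one_le_l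

theorem radius_pos (k : ℕ) : 0 < S.radius k := div_pos (Real.exp_pos _) S.l_pos

theorem core_pos (k : ℕ) : 0 < S.core k := by
  have := S.l_pos
  unfold core
  positivity

theorem radius_mul_le (k : ℕ) : S.radius k * ((S.N k : ℝ) + 1) ≤ 2 ^ k / 128 := by
  have hl := S.l_pos
  have h := S.scale_le k
  have h1 : Real.exp (neck k / 2) ≤ Real.exp (((k : ℝ) + 1) / 4) := by
    refine Real.exp_le_exp.2 ?_
    have := neck_pos k
    unfold neck at *
    linarith
  rw [radius, div_mul_eq_mul_div, div_le_iff₀ hl]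
  have : Real.exp (neck k / 2) * ((S.N k : ℝ) + 1) ≤
      Real.exp (((k : ℝ) + 1) / 4) * ((S.N k : ℝ) + 1) := by gcongr
  linarith

theorem radius_le (k : ℕ) : S.radius k ≤ 2 ^ k / 128 :=
  (le_mul_of_one_le_right (S.radius_pos k).le (by
    have : (0 : ℝ) ≤ S.N k := by positivity
    linarith)).trans (S.radius_mul_le k)

theorem exp_neck_le (k : ℕ) : Real.exp (neck k) ≤ S.l * 2 ^ k / 128 := by
  have h := S.scale_le k
  have h1 : Real.exp (((k : ℝ) + 1) / 4) ≤ Real.exp (((k : ℝ) + 1) / 4) * ((S.N k : ℝ) + 1) :=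
    le_mul_of_one_le_right (Real.exp_pos _).le (by
      have : (0 : ℝ) ≤ S.N k := by positivity
      linarith)
  unfold neck
  linarith

theorem exp_neck_mul_profile_le (k : ℕ) : Real.exp (neck k * profile 0) ≤ Real.exp (neck k) := by
  refine Real.exp_le_exp.2 (mul_le_of_le_one_right (neck_pos k).le ?_)
  simpa using profile_le_one_sub (s := 0) zero_le_one

/-- Keeps the core inside the spherical range of its bubble. -/
theorem l_mul_core_le (k : ℕ) : S.l * S.core k ≤ 1 / 4 := by
  have hl := S.l_pos
  have h1 := (exp_neck_mul_profile_le k).trans (S.exp_neck_le k)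
  have h2 : S.l * S.core k = 32 * Real.exp (neck k * profile 0) / (S.l * 2 ^ k) := by
    unfold core
    field_simp
  rw [h2, div_le_iff₀ (by positivity)]
  linarith

theorem core_le_radius (k : ℕ) : S.core k ≤ S.radius k := by
  have h := S.l_mul_core_le k
  have h1 : 1 ≤ Real.exp (neck k / 2) := Real.one_le_exp (by linarith [neck_pos k])
  rw [radius, le_div_iff₀ S.l_pos, mul_comm]
  linarith

theorem center_apply₀ (i : S.Index) : S.center i S.i₀ = 2 ^ i.1 / 8 := by
  simp [center, coordVec, S.ne₀₁]

theorem center_apply₁ (i : S.Index) : S.center i S.i₁ = 3 * S.radius i.1 * (i.2 : ℕ) := by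
  simp [center, coordVec, S.ne₀₁.symm]

theorem center_apply₂ (i : S.Index) : S.center i S.i₂ = 0 := by
  simp [center, coordVec, S.ne₀₂.symm, S.ne₁₂.symm]

theorem abs_sub_le_of_norm_sub_le {x c : EuclideanSpace ℝ (Fin n)} {r : ℝ} (h : ‖x - c‖ ≤ r)
    (a : Fin n) : |x a - c a| ≤ r := by
  have := (PiLp.norm_apply_le (x - c) a).trans h
  simpa using this

/-- Already the projections of the bubbles to the plane of the first two axes are disjoint:
different sizes are separated by the coordinate near `2 ^ k / 8`, equal sizes by the spacing of
three radii. Hence a line along the third axis through one bubble meets no other. -/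
theorem index_eq_of_le {i i' : S.Index} (hle : i.1 ≤ i'.1) {s t : ℝ}
    (h0 : |s - 2 ^ i.1 / 8| ≤ S.radius i.1) (h1 : |t - 3 * S.radius i.1 * (i.2 : ℕ)| ≤ S.radius i.1)
    (h0' : |s - 2 ^ i'.1 / 8| ≤ S.radius i'.1)
    (h1' : |t - 3 * S.radius i'.1 * (i'.2 : ℕ)| ≤ S.radius i'.1) : i = i' := by
  obtain ⟨k, j⟩ := i
  obtain ⟨k', j'⟩ := i'
  simp only at *
  have hr := S.radius_le k
  have hr' := S.radius_le k'
  have hp : (0 : ℝ) < 2 ^ k := by positivity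
  rw [abs_le] at *
  rcases hle.eq_or_lt with h | h
  · subst h
    have hR := S.radius_pos k
    suffices hj : (j : ℕ) = j' by
      rw [Fin.ext hj]
    have h3 : 3 * S.radius k * ((j : ℕ) - (j' : ℕ) : ℝ) ≤ 2 * S.radius k := by linarith
    have h4 : 3 * S.radius k * ((j' : ℕ) - (j : ℕ) : ℝ) ≤ 2 * S.radius k := by linarith
    rcases lt_trichotomy (j : ℕ) j' with hj | hj | hj
    · have : ((j : ℕ) : ℝ) + 1 ≤ (j' : ℕ) := by exact_mod_cast hj
      nlinarith
    · exact hj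
    · have : ((j' : ℕ) : ℝ) + 1 ≤ (j : ℕ) := by exact_mod_cast hj
      nlinarith
  · have h2 : (2 : ℝ) ^ (k + 1) ≤ 2 ^ k' := pow_le_pow_right₀ (by norm_num) h
    rw [pow_succ] at h2
    linarith

theorem index_eq {i i' : S.Index} {s t : ℝ}
    (h0 : |s - 2 ^ i.1 / 8| ≤ S.radius i.1) (h1 : |t - 3 * S.radius i.1 * (i.2 : ℕ)| ≤ S.radius i.1)
    (h0' : |s - 2 ^ i'.1 / 8| ≤ S.radius i'.1)
    (h1' : |t - 3 * S.radius i'.1 * (i'.2 : ℕ)| ≤ S.radius i'.1) : i = i' := by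
  rcases le_total i.1 i'.1 with h | h
  · exact S.index_eq_of_le h h0 h1 h0' h1'
  · exact (S.index_eq_of_le h h0' h1' h0 h1).symm

theorem coord_of_mem {i : S.Index} {x : EuclideanSpace ℝ (Fin n)}
    (h : ‖x - S.center i‖ ≤ S.radius i.1) :
    |x S.i₀ - 2 ^ i.1 / 8| ≤ S.radius i.1 ∧
    |x S.i₁ - 3 * S.radius i.1 * (i.2 : ℕ)| ≤ S.radius i.1 ∧ |x S.i₂| ≤ S.radius i.1 := by
  refine ⟨?_, ?_, ?_⟩
  · simpa [center_apply₀] using abs_sub_le_of_norm_sub_le h S.i₀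
  · simpa [center_apply₁] using abs_sub_le_of_norm_sub_le h S.i₁
  · simpa [center_apply₂] using abs_sub_le_of_norm_sub_le h S.i₂

theorem single_eq_zero {i : S.Index} {x : EuclideanSpace ℝ (Fin n)}
    (h : S.radius i.1 ≤ ‖x - S.center i‖) : S.single i x = 0 := by
  refine bubble_eq_zero (neck_pos _) ?_
  have hl := S.l_pos
  have h1 : Real.exp (neck i.1) = S.l ^ 2 * S.radius i.1 ^ 2 := by
    rw [radius, div_pow, mul_div_cancel₀ _ (by positivity), ← Real.exp_nat_mul]
    congr 1
    push_cast
    ring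
  rw [h1]
  have h2 : S.radius i.1 ^ 2 ≤ ‖x - S.center i‖ ^ 2 :=
    pow_le_pow_left₀ (S.radius_pos _).le h 2
  have h3 : S.radius i.1 ^ 2 ≤ S.core i.1 ^ 2 + ‖x - S.center i‖ ^ 2 := by
    linarith [sq_nonneg (S.core i.1)]
  gcongr

theorem exponent_eq_single {i : S.Index} {x : EuclideanSpace ℝ (Fin n)}
    (h : ∀ i', i' ≠ i → S.radius i'.1 ≤ ‖x - S.center i'‖) : S.exponent x = S.single i x :=
  finsum_eq_single _ i fun i' hi' => S.single_eq_zero (h i' hi')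

theorem exponent_eq_zero {x : EuclideanSpace ℝ (Fin n)}
    (h : ∀ i, S.radius i.1 ≤ ‖x - S.center i‖) : S.exponent x = 0 :=
  finsum_eq_zero_of_forall_eq_zero fun i => S.single_eq_zero (h i)

/-- Bubbles of size `2 ^ k` have first coordinate at least `2 ^ k / 16`, so a bounded set meets
finitely many sizes. -/
theorem locallyFinite_closedBall :
    LocallyFinite fun i : S.Index => _root_.Metric.closedBall (S.center i) (S.radius i.1) := by
  intro x
  refine ⟨_root_.Metric.ball x 1, _root_.Metric.ball_mem_nhds x one_pos, ?_⟩
  obtain ⟨K, hK⟩ := pow_unbounded_of_one_lt (16 * (x S.i₀ + 1)) (one_lt_two (α := ℝ))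
  refine ((Finset.range K).sigma fun k => (Finset.univ : Finset (Fin (S.N k)))).finite_toSet.subset
    fun i hi => ?_
  obtain ⟨z, hz, hzx⟩ := hi
  rw [mem_closedBall_iff_norm] at hz
  rw [mem_ball_iff_norm] at hzx
  have h1 := abs_le.1 (S.coord_of_mem hz).1
  have h2 := abs_le.1 (abs_sub_le_of_norm_sub_le hzx.le S.i₀)
  have hr := S.radius_le i.1
  have hp : (0 : ℝ) < 2 ^ i.1 := by positivity
  simp only [Finset.coe_sigma, mem_sigma_iff, Finset.coe_range, mem_Iio, Finset.coe_univ, mem_univ,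
    and_true]
  have : (2 : ℝ) ^ i.1 < 2 ^ K := by linarith
  exact (pow_lt_pow_iff_right₀ one_lt_two).1 this

theorem exponent_eventuallyEq (x : EuclideanSpace ℝ (Fin n)) :
    (∃ i, S.exponent =ᶠ[nhds x] S.single i) ∨ S.exponent =ᶠ[nhds x] fun _ => 0 := by
  by_cases h : ∃ i, ‖x - S.center i‖ ≤ S.radius i.1
  · obtain ⟨i, hi⟩ := h
    left
    refine ⟨i, ?_⟩
    have hc : IsClosed (⋃ i' : {i' : S.Index // i' ≠ i},
        _root_.Metric.closedBall (S.center i') (S.radius i'.1.1)) :=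
      (S.locallyFinite_closedBall.comp_injective Subtype.val_injective).isClosed_iUnion
        fun _ => Metric.isClosed_closedBall
    have hx : x ∉ ⋃ i' : {i' : S.Index // i' ≠ i},
        _root_.Metric.closedBall (S.center i') (S.radius i'.1.1) := by
      rw [mem_iUnion]
      rintro ⟨⟨i', hne⟩, hi'⟩
      rw [mem_closedBall_iff_norm] at hi'
      have a := S.coord_of_mem hi
      have b := S.coord_of_mem hi'
      exact hne (S.index_eq b.1 b.2.1 a.1 a.2.1)
    filter_upwards [hc.isOpen_compl.mem_nhds hx] with z hz
    refine S.exponent_eq_single fun i' hne => ?_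
    by_contra! hlt
    exact hz (mem_iUnion.2 ⟨⟨i', hne⟩, mem_closedBall_iff_norm.2 hlt.le⟩)
  · right
    have hc : IsClosed (⋃ i : S.Index, _root_.Metric.closedBall (S.center i) (S.radius i.1)) :=
      S.locallyFinite_closedBall.isClosed_iUnion fun _ => Metric.isClosed_closedBall
    have hx : x ∉ ⋃ i : S.Index, _root_.Metric.closedBall (S.center i) (S.radius i.1) := by
      rw [mem_iUnion]
      rintro ⟨i, hi⟩
      exact h ⟨i, mem_closedBall_iff_norm.1 hi⟩
    filter_upwards [hc.isOpen_compl.mem_nhds hx] with z hz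
    refine S.exponent_eq_zero fun i => ?_
    by_contra! hlt
    exact hz (mem_iUnion.2 ⟨i, mem_closedBall_iff_norm.2 hlt.le⟩)

theorem contDiff_single (i : S.Index) : ContDiff ℝ ∞ (S.single i) :=
  contDiff_bubble S.l_pos (S.core_pos _) _

theorem contDiff_exponent : ContDiff ℝ ∞ S.exponent := by
  rw [contDiff_iff_contDiffAt]
  intro x
  rcases S.exponent_eventuallyEq x with ⟨i, hi⟩ | h
  · exact (S.contDiff_single i).contDiffAt.congr_of_eventuallyEq hi
  · exact contDiffAt_const.congr_of_eventuallyEq h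

theorem exponent_nonneg (x : EuclideanSpace ℝ (Fin n)) : 0 ≤ S.exponent x :=
  finsum_nonneg fun _ => bubble_nonneg (neck_pos _) _

/-- The metric of the configuration. -/
noncomputable def metric : Metric n := conformalMetric S.exponent S.contDiff_exponent

theorem isConformal_metric : S.metric.IsConformal S.exponent :=
  fun _ _ _ => form_conformalMetric _ _ _ _ _

theorem isComplete_metric : S.metric.IsComplete :=
  isComplete_conformalMetric _ _ S.exponent_nonneg

/-- The curvature defect of a single bubble. -/
noncomputable def defect (i : S.Index) (x : EuclideanSpace ℝ (Fin n)) : ℝ :=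
  bubbleDefect (neck i.1) S.l (S.core i.1) (‖x - S.center i‖ ^ 2)

theorem defect_nonneg (i : S.Index) (x : EuclideanSpace ℝ (Fin n)) : 0 ≤ S.defect i x :=
  bubbleDefect_nonneg (neck_pos _) (S.core_pos _) (sq_nonneg _)

theorem exists_neg_le_sec (x : EuclideanSpace ℝ (Fin n)) :
    ∃ m, (m = 0 ∨ ∃ i, m = S.defect i x) ∧ ∀ κ ∈ S.metric.secSet x,
      -(m * Real.exp (-(2 * S.exponent x))) ≤ κ := by
  rcases S.exponent_eventuallyEq x with ⟨i, hi⟩ | h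
  · refine ⟨S.defect i x, Or.inr ⟨i, rfl⟩, ?_⟩
    rintro κ ⟨u, v, huv, rfl⟩
    exact S.isConformal_metric.neg_bubbleDefect_le_sec S.contDiff_exponent (neck_pos _) S.l_pos
      (S.core_pos _) hi huv
  · refine ⟨0, Or.inl rfl, ?_⟩
    rintro κ ⟨u, v, huv, rfl⟩
    have hS := schouten_of_eventuallyEq_radial (f := S.exponent) (c := 0) (Φ := fun _ => 0)
      (Φ₁ := fun _ => 0) h (fun q _ => hasDerivAt_const q 0) (hasDerivAt_const _ 0)
    exact S.isConformal_metric.neg_le_sec S.contDiff_exponent hS (by simp) le_rfl (by simp) huv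

end BubbleConfig

end RiemannRn

/-! ### Distances and volumes in a configuration. -/

namespace RiemannRn

open MeasureTheory Set

theorem lintegral_Icc_ofReal_eq_sub {φ G : ℝ → ℝ} {L : ℝ} (hL : 0 ≤ L) (hφ : Continuous φ)
    (h0 : ∀ s, 0 ≤ φ s) (hG : ∀ s, HasDerivAt G (φ s) s) :
    ∫⁻ s in Icc 0 L, ENNReal.ofReal (φ s) = ENNReal.ofReal (G L - G 0) := by
  rw [← intervalIntegral.integral_eq_sub_of_hasDerivAt (fun s _ => hG s)
    (hφ.intervalIntegrable 0 L), intervalIntegral.integral_of_le hL,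
    ← integral_Icc_eq_integral_Ioc, ofReal_integral_eq_lintegral_ofReal
    hφ.continuousOn.integrableOn_Icc (Filter.Eventually.of_forall h0)]

/-- The primitive is an arctangent, whose total variation `π ≤ 4` depends neither on the offset `d`
nor on `L`. -/
theorem lintegral_lorentzian_le {A B c₁ c₂ d L : ℝ} (hA : 0 ≤ A) (hB : 0 ≤ B) (hc₁ : 0 < c₁)
    (hc₂ : 0 < c₂) (hL : 0 ≤ L) :
    ∫⁻ s in Icc 0 L, ENNReal.ofReal (1 + A / (c₁ ^ 2 + (s + d) ^ 2) + B / (c₂ ^ 2 + (s + d) ^ 2)) ≤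
      ENNReal.ofReal (L + 4 * (A / c₁ + B / c₂)) := by
  have hat : ∀ c : ℝ, 0 < c → ∀ s, HasDerivAt (fun s => Real.arctan ((s + d) / c) / c)
      (1 / (c ^ 2 + (s + d) ^ 2)) s := by
    intro c hc s
    have h := ((((hasDerivAt_id s).add_const d).div_const c).arctan).div_const c
    refine h.congr_deriv ?_
    simp only [id]
    have : 0 < c ^ 2 + (s + d) ^ 2 := by positivity
    field_simp
  have hG : ∀ s, HasDerivAt (fun s => s + A * (Real.arctan ((s + d) / c₁) / c₁)
      + B * (Real.arctan ((s + d) / c₂) / c₂))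
      (1 + A / (c₁ ^ 2 + (s + d) ^ 2) + B / (c₂ ^ 2 + (s + d) ^ 2)) s := by
    intro s
    refine (((hasDerivAt_id s).add ((hat c₁ hc₁ s).const_mul A)).add
      ((hat c₂ hc₂ s).const_mul B)).congr_deriv ?_
    ring
  rw [lintegral_Icc_ofReal_eq_sub hL ?_ ?_ hG]
  · refine ENNReal.ofReal_le_ofReal ?_
    have hb : ∀ (c M : ℝ), 0 < c → 0 ≤ M → M * (Real.arctan ((L + d) / c) / c)
        - M * (Real.arctan ((0 + d) / c) / c) ≤ 4 * (M / c) := by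
      intro c M hc hM
      have h1 := Real.arctan_lt_pi_div_two ((L + d) / c)
      have h2 := Real.neg_pi_div_two_lt_arctan ((0 + d) / c)
      have h3 := Real.pi_le_four
      have h4 : 0 ≤ M / c := by positivity
      calc _ = M / c * (Real.arctan ((L + d) / c) - Real.arctan ((0 + d) / c)) := by ring
        _ ≤ M / c * 4 := by gcongr; linarith
        _ = _ := by ring
    have h1 := hb c₁ A hc₁ hA
    have h2 := hb c₂ B hc₂ hB
    linarith
  · have h1 : ∀ s : ℝ, c₁ ^ 2 + (s + d) ^ 2 ≠ 0 := fun s => by positivity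
    have h2 : ∀ s : ℝ, c₂ ^ 2 + (s + d) ^ 2 ≠ 0 := fun s => by positivity
    fun_prop (disch := assumption)
  · intro s
    positivity

theorem norm_coordVec {n : ℕ} (i : Fin n) : ‖coordVec i‖ = 1 := by
  simp [coordVec]

namespace BubbleConfig

variable {n : ℕ} (S : BubbleConfig n)

theorem geodDist_le_norm {z : EuclideanSpace ℝ (Fin n)}
    (hz : ∀ t : ℝ, 0 ≤ t → S.exponent (t • z) = 0) :
    S.metric.geodDist 0 z ≤ ENNReal.ofReal ‖z‖ := by
  have h := geodDist_conformalMetric_le_ofReal S.exponent S.contDiff_exponent 0 z (L := 1)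
    (M := ‖z‖) zero_le_one fun t ht => by
      rw [zero_add, hz t ht.1, Real.exp_zero, one_mul]
  rw [one_smul, zero_add, mul_one] at h
  exact h

/-- In a bubble the first coordinate is positive and far exceeds the third; the ray through `z`
never has this property. -/
theorem exponent_smul_eq_zero {z : EuclideanSpace ℝ (Fin n)} (hz : z S.i₀ ≤ 0 ∨ z S.i₀ ≤ z S.i₂)
    {t : ℝ} (ht : 0 ≤ t) : S.exponent (t • z) = 0 := by
  refine S.exponent_eq_zero fun i => ?_
  by_contra! hlt
  obtain ⟨h0, -, h2⟩ := S.coord_of_mem hlt.le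
  have hr := S.radius_le i.1
  have hp : (0 : ℝ) < 2 ^ i.1 := by positivity
  simp only [PiLp.smul_apply, smul_eq_mul] at h0 h2
  rw [abs_le] at h0 h2
  rcases hz with hz | hz
  · have := mul_nonpos_of_nonneg_of_nonpos ht hz
    linarith
  · have := mul_le_mul_of_nonneg_left hz ht
    linarith

theorem mem_ball_of_neg {k : ℕ} {y : EuclideanSpace ℝ (Fin n)}
    (hy : y ∈ _root_.Metric.ball (-(2 ^ k / 2 : ℝ) • coordVec S.i₀) (2 ^ k / 2)) :
    y ∈ S.metric.ball 0 (2 ^ k) := by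
  rw [mem_ball_iff_norm] at hy
  have h0 := abs_le.1 (abs_sub_le_of_norm_sub_le hy.le S.i₀)
  have hy0 : y S.i₀ ≤ 0 := by
    have : (coordVec S.i₀ : EuclideanSpace ℝ (Fin n)) S.i₀ = 1 := by simp [coordVec]
    simp only [PiLp.smul_apply, smul_eq_mul, this] at h0
    linarith
  have hn : ‖y‖ < 2 ^ k := by
    have h1 : ‖(-(2 ^ k / 2 : ℝ) • coordVec S.i₀ : EuclideanSpace ℝ (Fin n))‖ = 2 ^ k / 2 := by
      rw [norm_smul, norm_coordVec, mul_one, norm_neg, Real.norm_of_nonneg (by positivity)]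
    have h2 := norm_le_insert' y (-(2 ^ k / 2 : ℝ) • coordVec S.i₀)
    linarith
  exact (S.geodDist_le_norm fun t ht => S.exponent_smul_eq_zero (Or.inl hy0) ht).trans_lt
    ((ENNReal.ofReal_lt_ofReal_iff (by positivity)).2 hn)

theorem exp_exponent_vertical_le {i : S.Index} {y : EuclideanSpace ℝ (Fin n)}
    (hy : ‖y - S.center i‖ ≤ S.core i.1) (s : ℝ) :
    Real.exp (S.exponent (y + s • coordVec S.i₂)) ≤
      1 + (Real.exp (neck i.1 * profile 0) / S.l ^ 2) / (S.core i.1 ^ 2 + (s + y S.i₂) ^ 2)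
        + (2 * Real.exp (neck i.1) / S.l ^ 2) / ((1 / S.l) ^ 2 + (s + y S.i₂) ^ 2) := by
  have hl := S.l_pos
  have hc := S.core_pos i.1
  have hcoord := S.coord_of_mem (hy.trans (S.core_le_radius _))
  set x := y + s • coordVec S.i₂ with hx
  have hx0 : x S.i₀ = y S.i₀ := by simp [hx, coordVec, S.ne₀₂]
  have hx1 : x S.i₁ = y S.i₁ := by simp [hx, coordVec, S.ne₁₂]
  have hx2 : x S.i₂ = s + y S.i₂ := by simp [hx, coordVec, add_comm]
  have hsingle : S.exponent x = S.single i x := by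
    refine S.exponent_eq_single fun i' hne => ?_
    by_contra! hlt
    have h := S.coord_of_mem hlt.le
    rw [hx0, hx1] at h
    exact hne (S.index_eq h.1 h.2.1 hcoord.1 hcoord.2.1)
  have hq : (s + y S.i₂) ^ 2 ≤ ‖x - S.center i‖ ^ 2 := by
    have := PiLp.norm_apply_le (x - S.center i) S.i₂
    simp only [PiLp.sub_apply, S.center_apply₂, sub_zero, hx2, Real.norm_eq_abs] at this
    rw [← sq_abs]
    exact pow_le_pow_left₀ (abs_nonneg _) this 2
  rw [hsingle]
  refine (exp_bubble_le (neck_pos _) hl hc (sq_nonneg _)).trans ?_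
  rw [div_div, div_div]
  have h1 : S.l ^ 2 * ((1 / S.l) ^ 2 + (s + y S.i₂) ^ 2) = 1 + S.l ^ 2 * (s + y S.i₂) ^ 2 := by
    field_simp
  rw [h1]
  have h2 : S.l ^ 2 * (s + y S.i₂) ^ 2 ≤ S.l ^ 2 * (S.core i.1 ^ 2 + ‖x - S.center i‖ ^ 2) := by
    have := sq_nonneg (S.core i.1)
    gcongr
    linarith
  gcongr

/-- Go straight from the origin to the point `z` above `y`, through flat space, then descend along
the third axis. The lengths are at most `2 ^ k / 2` and `(1/4 + 4/32 + 4/64) 2 ^ k = 7/16 · 2 ^ k`,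
the latter for the flat, spherical and neck contributions. -/
theorem mem_ball_of_core {i : S.Index} {y : EuclideanSpace ℝ (Fin n)}
    (hy : y ∈ _root_.Metric.ball (S.center i) (S.core i.1)) : y ∈ S.metric.ball 0 (2 ^ i.1) := by
  rw [mem_ball_iff_norm] at hy
  have hl := S.l_pos
  have hc := S.core_pos i.1
  have hcr := S.core_le_radius i.1
  have hr := S.radius_le i.1
  have hp : (0 : ℝ) < 2 ^ i.1 := by positivity
  have hcoord := S.coord_of_mem (hy.le.trans hcr)
  set k := i.1 with hk
  set z := y + (2 ^ k / 4 : ℝ) • coordVec S.i₂ with hz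
  have hz0 : z S.i₀ = y S.i₀ := by simp [hz, coordVec, S.ne₀₂]
  have hz2 : z S.i₂ = y S.i₂ + 2 ^ k / 4 := by simp [hz, coordVec]
  have hzi : z S.i₀ ≤ z S.i₂ := by
    have h0 := abs_le.1 hcoord.1
    have h2 := abs_le.1 hcoord.2.2
    rw [hz0, hz2]
    linarith
  have hcenter : ‖S.center i‖ ≤ 2 ^ k / 8 + 3 * (2 ^ k / 128) := by
    have hj : ((i.2 : ℕ) : ℝ) ≤ (S.N k : ℝ) + 1 := by
      have : (i.2 : ℕ) < S.N k := i.2.2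
      have : ((i.2 : ℕ) : ℝ) < S.N k := by exact_mod_cast this
      linarith
    have hR := S.radius_mul_le k
    have hR0 := S.radius_pos k
    refine (norm_add_le _ _).trans ?_
    rw [norm_smul, norm_smul, norm_coordVec, norm_coordVec, mul_one, mul_one,
      Real.norm_of_nonneg (by positivity), Real.norm_of_nonneg (by positivity)]
    have : S.radius k * (i.2 : ℕ) ≤ S.radius k * ((S.N k : ℝ) + 1) := by gcongr
    linarith
  have hznorm : ‖z‖ ≤ 2 ^ k / 2 := by
    have h1 : ‖z‖ ≤ ‖y‖ + 2 ^ k / 4 := by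
      refine (norm_add_le _ _).trans ?_
      rw [norm_smul, norm_coordVec, mul_one, Real.norm_of_nonneg (by positivity)]
    have h2 := norm_le_insert' y (S.center i)
    linarith
  have hd1 : S.metric.geodDist 0 z ≤ ENNReal.ofReal (2 ^ k / 2) :=
    (S.geodDist_le_norm fun t ht => S.exponent_smul_eq_zero (Or.inr hzi) ht).trans
      (ENNReal.ofReal_le_ofReal hznorm)
  have hd2 : S.metric.geodDist y z ≤ ENNReal.ofReal (7 / 16 * 2 ^ k) := by
    refine (geodDist_conformalMetric_le_lintegral S.exponent S.contDiff_exponent y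
      (coordVec S.i₂) (by positivity)).trans ?_
    refine (lintegral_mono fun s => ENNReal.ofReal_le_ofReal ?_).trans
      ((lintegral_lorentzian_le (A := Real.exp (neck k * profile 0) / S.l ^ 2)
        (B := 2 * Real.exp (neck k) / S.l ^ 2) (c₁ := S.core k) (c₂ := 1 / S.l) (d := y S.i₂)
        (by positivity) (by positivity) hc (by positivity) (by positivity)).trans
        (ENNReal.ofReal_le_ofReal ?_))
    · rw [norm_coordVec, mul_one]
      exact S.exp_exponent_vertical_le hy.le s
    -- The radius `core k` is chosen to make this spherical contribution exactly `2 ^ k / 32`.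
    · have h1 : Real.exp (neck k * profile 0) / S.l ^ 2 / S.core k = 2 ^ k / 32 := by
        unfold core
        field_simp
      have h2 : 2 * Real.exp (neck k) / S.l ^ 2 / (1 / S.l) = 2 * Real.exp (neck k) / S.l := by
        field_simp
      have h3 : 2 * Real.exp (neck k) / S.l ≤ 2 ^ k / 64 := by
        rw [div_le_iff₀ hl]
        have := S.exp_neck_le k
        linarith
      rw [h1, h2]
      linarith
  rw [geodDist_comm] at hd2
  refine (geodDist_triangle _ 0 z y).trans_lt ((add_le_add hd1 hd2).trans_lt ?_)
  rw [← ENNReal.ofReal_add (by positivity) (by positivity),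
    ENNReal.ofReal_lt_ofReal_iff (by positivity)]
  linarith

theorem vol_eq_withDensity : S.metric.vol =
    volume.withDensity fun x => ENNReal.ofReal (Real.exp (S.exponent x) ^ n) := by
  unfold Metric.vol
  simp only [S.isConformal_metric.sqrt_det_coeff]

theorem measurable_density :
    Measurable fun x => ENNReal.ofReal (Real.exp (S.exponent x) ^ n) := by
  have := S.contDiff_exponent.continuous
  exact ENNReal.measurable_ofReal.comp (by fun_prop : Continuous fun x =>
    Real.exp (S.exponent x) ^ n).measurable

theorem mul_volume_le_vol {A : ℝ} (hA : 0 ≤ A) {s : Set (EuclideanSpace ℝ (Fin n))}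
    (hs : MeasurableSet s) (h : ∀ x ∈ s, A ≤ Real.exp (S.exponent x)) :
    ENNReal.ofReal (A ^ n) * volume s ≤ S.metric.vol s := by
  rw [vol_eq_withDensity, withDensity_apply _ hs, ← setLIntegral_const]
  exact setLIntegral_mono' hs fun x hx => ENNReal.ofReal_le_ofReal
    (pow_le_pow_left₀ hA (h x hx) n)

/-- Uses the half space opposite to the bubbles, where radial segments stay flat. -/
theorem half_pow_mul_le_vol_ball (k : ℕ) :
    ENNReal.ofReal ((2 ^ k / 2) ^ n) * volume (_root_.Metric.ball (0 : EuclideanSpace ℝ (Fin n)) 1) ≤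
      S.metric.vol (S.metric.ball 0 (2 ^ k)) := by
  have h := S.mul_volume_le_vol (A := 1) zero_le_one (s := _root_.Metric.ball
    (-(2 ^ k / 2 : ℝ) • coordVec S.i₀ : EuclideanSpace ℝ (Fin n)) (2 ^ k / 2)) measurableSet_ball
    fun x _ => Real.one_le_exp (S.exponent_nonneg x)
  rw [one_pow, ENNReal.ofReal_one, one_mul, Measure.addHaar_ball_of_pos _ _ (by positivity),
    finrank_euclideanSpace, Fintype.card_fin] at h
  exact h.trans (measure_mono fun y hy => S.mem_ball_of_neg hy)

/-- On the core `b² + q ≤ 2b²`, so the spherical factor is at least half its central value `2 ^ k /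
(32 b)`. -/
theorem le_exp_exponent_of_core {i : S.Index} {y : EuclideanSpace ℝ (Fin n)}
    (hy : y ∈ _root_.Metric.ball (S.center i) (S.core i.1)) :
    2 ^ i.1 / (64 * S.core i.1) ≤ Real.exp (S.exponent y) := by
  rw [mem_ball_iff_norm] at hy
  have hl := S.l_pos
  have hc := S.core_pos i.1
  have hcoord := S.coord_of_mem (hy.le.trans (S.core_le_radius _))
  have hsingle : S.exponent y = S.single i y := by
    refine S.exponent_eq_single fun i' hne => ?_
    by_contra! hlt
    have h := S.coord_of_mem hlt.le
    exact hne (S.index_eq h.1 h.2.1 hcoord.1 hcoord.2.1)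
  have hq : ‖y - S.center i‖ ^ 2 ≤ S.core i.1 ^ 2 := pow_le_pow_left₀ (norm_nonneg _) hy.le 2
  have hw : S.l ^ 2 * (S.core i.1 ^ 2 + ‖y - S.center i‖ ^ 2) ≤
      S.l ^ 2 * (2 * S.core i.1 ^ 2) := by
    gcongr
    linarith
  have h1 : S.l ^ 2 * (2 * S.core i.1 ^ 2) ≤ 1 := by
    have := S.l_mul_core_le i.1
    have h0 : 0 ≤ S.l * S.core i.1 := by positivity
    nlinarith
  rw [hsingle, single, exp_bubble_of_le_one (neck_pos _) hl hc (sq_nonneg _) (hw.trans h1)]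
  have h2 : (2 : ℝ) ^ i.1 / (64 * S.core i.1) =
      Real.exp (neck i.1 * profile 0) / (S.l ^ 2 * (2 * S.core i.1 ^ 2)) := by
    have h3 : Real.exp (neck i.1 * profile 0) = S.core i.1 * (S.l ^ 2 * 2 ^ i.1) / 32 := by
      unfold core
      field_simp
    rw [h3]
    field_simp
    norm_num
  rw [h2]
  gcongr

theorem card_mul_le_vol_ball (k : ℕ) :
    (S.N k : ℝ≥0∞) * (ENNReal.ofReal ((2 ^ k / 64) ^ n) *
      volume (_root_.Metric.ball (0 : EuclideanSpace ℝ (Fin n)) 1)) ≤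
      S.metric.vol (S.metric.ball 0 (2 ^ k)) := by
  have hc := S.core_pos k
  set B : Fin (S.N k) → Set (EuclideanSpace ℝ (Fin n)) :=
    fun j => _root_.Metric.ball (S.center ⟨k, j⟩) (S.core k) with hB
  have hdisj : Pairwise (Function.onFun Disjoint B) := by
    intro j j' hne
    rw [Function.onFun, Set.disjoint_left]
    intro x hx hx'
    rw [hB, mem_ball_iff_norm] at hx hx'
    have a := S.coord_of_mem (i := ⟨k, j⟩) (hx.le.trans (S.core_le_radius _))
    have b := S.coord_of_mem (i := ⟨k, j'⟩) (hx'.le.trans (S.core_le_radius _))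
    have := S.index_eq a.1 a.2.1 b.1 b.2.1
    simp only [Sigma.mk.injEq, heq_eq_eq, true_and] at this
    exact hne this
  have hvol : ∀ j, ENNReal.ofReal ((2 ^ k / 64) ^ n) *
      volume (_root_.Metric.ball (0 : EuclideanSpace ℝ (Fin n)) 1) ≤ S.metric.vol (B j) := by
    intro j
    have h := S.mul_volume_le_vol (A := 2 ^ k / (64 * S.core k)) (by positivity)
      (measurableSet_ball (x := S.center ⟨k, j⟩) (ε := S.core k))
      fun x hx => S.le_exp_exponent_of_core (i := ⟨k, j⟩) hx
    rw [Measure.addHaar_ball_of_pos _ _ hc, finrank_euclideanSpace, Fintype.card_fin, ← mul_assoc,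
      ← ENNReal.ofReal_mul (by positivity), ← mul_pow] at h
    have h1 : 2 ^ k / (64 * S.core k) * S.core k = 2 ^ k / 64 := by field_simp
    rwa [h1] at h
  calc (S.N k : ℝ≥0∞) * (ENNReal.ofReal ((2 ^ k / 64) ^ n) *
      volume (_root_.Metric.ball (0 : EuclideanSpace ℝ (Fin n)) 1))
      = ∑ _j : Fin (S.N k), ENNReal.ofReal ((2 ^ k / 64) ^ n) *
        volume (_root_.Metric.ball (0 : EuclideanSpace ℝ (Fin n)) 1) := by simp
    _ ≤ ∑ j, S.metric.vol (B j) := Finset.sum_le_sum fun j _ => hvol j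
    _ = S.metric.vol (⋃ j, B j) := by
        rw [measure_iUnion hdisj fun j => measurableSet_ball, tsum_fintype]
    _ ≤ _ := measure_mono (iUnion_subset fun j y hy => S.mem_ball_of_core (i := ⟨k, j⟩) hy)

end BubbleConfig

end RiemannRn

/-! ### Curvature bound and total curvature integral. -/

namespace RiemannRn

open MeasureTheory Set

theorem Metric.sigmaMinus_mem_Icc {n : ℕ} {g : Metric n} {x : EuclideanSpace ℝ (Fin n)} {m : ℝ}
    (hm : 0 ≤ m) (h : ∀ κ ∈ g.secSet x, -m ≤ κ) : g.sigmaMinus x ∈ Icc 0 m := by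
  unfold Metric.sigmaMinus
  split_ifs with h0
  · exact ⟨le_rfl, hm⟩
  · push Not at h0
    obtain ⟨κ, hκ, hneg⟩ := h0
    have h1 : sInf (g.secSet x) ≤ κ := csInf_le ⟨-m, h⟩ hκ
    have h2 : -m ≤ sInf (g.secSet x) := le_csInf ⟨κ, hκ⟩ h
    constructor <;> linarith

namespace BubbleConfig

variable {n : ℕ} (S : BubbleConfig n)

theorem secBoundedBelow_metric : S.metric.SecBoundedBelow := by
  obtain ⟨C, hC0, hC⟩ := exists_profileCurv_le
  refine ⟨-(16 * C * S.l ^ 2), fun x κ hκ => ?_⟩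
  obtain ⟨m, hm, hsec⟩ := S.exists_neg_le_sec x
  have hm' : 0 ≤ m ∧ m ≤ 16 * C * S.l ^ 2 := by
    rcases hm with rfl | ⟨i, rfl⟩
    · exact ⟨le_rfl, by positivity⟩
    · refine ⟨S.defect_nonneg i x, (bubbleDefect_le (neck_pos _) S.l_pos (S.core_pos _) hC0.le hC
        (sq_nonneg _)).trans ?_⟩
      rw [div_le_iff₀ (neck_pos _)]
      have h1 := mul_le_mul_of_nonneg_left (quarter_le_neck i.1)
        (show 0 ≤ 16 * C * S.l ^ 2 by positivity)
      linarith
  have hE : Real.exp (-(2 * S.exponent x)) ≤ 1 :=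
    Real.exp_le_one_iff.2 (by linarith [S.exponent_nonneg x])
  have := mul_le_of_le_one_right hm'.1 hE
  linarith [hsec κ hκ]

/-- Conformal invariance: the factor `e^(-2f)` of the curvature, raised to `n / 2`, cancels the
volume density `e^(nf)`. -/
theorem sigmaMinus_rpow_mul_density_le (hn : 0 < n) (x : EuclideanSpace ℝ (Fin n)) :
    ENNReal.ofReal (Real.exp (S.exponent x) ^ n) *
      ENNReal.ofReal (S.metric.sigmaMinus x ^ ((n : ℝ) / 2)) ≤
      ∑' i, ENNReal.ofReal (S.defect i x ^ ((n : ℝ) / 2)) := by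
  obtain ⟨m, hm, hsec⟩ := S.exists_neg_le_sec x
  have hm0 : 0 ≤ m := by
    rcases hm with rfl | ⟨i, rfl⟩
    · exact le_rfl
    · exact S.defect_nonneg i x
  have hσ := Metric.sigmaMinus_mem_Icc (by positivity) hsec
  have h1 : Real.exp (S.exponent x) ^ n * S.metric.sigmaMinus x ^ ((n : ℝ) / 2) ≤
      m ^ ((n : ℝ) / 2) := by
    calc _ ≤ Real.exp (S.exponent x) ^ n *
          (m * Real.exp (-(2 * S.exponent x))) ^ ((n : ℝ) / 2) := by
          gcongr
          · exact hσ.1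
          · exact hσ.2
      _ = m ^ ((n : ℝ) / 2) := by
          rw [Real.mul_rpow hm0 (Real.exp_pos _).le, ← Real.exp_mul, ← Real.exp_nat_mul,
            mul_left_comm, ← Real.exp_add]
          have : (n : ℝ) * S.exponent x + -(2 * S.exponent x) * ((n : ℝ) / 2) = 0 := by ring
          rw [this, Real.exp_zero, mul_one]
  rw [← ENNReal.ofReal_mul (by positivity)]
  refine (ENNReal.ofReal_le_ofReal h1).trans ?_
  rcases hm with rfl | ⟨i, rfl⟩
  · rw [Real.zero_rpow (by positivity), ENNReal.ofReal_zero]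
    exact zero_le
  · exact ENNReal.le_tsum (f := fun i => ENNReal.ofReal (S.defect i x ^ ((n : ℝ) / 2))) i

theorem measurable_defect_rpow (i : S.Index) :
    Measurable fun x => ENNReal.ofReal (S.defect i x ^ ((n : ℝ) / 2)) := by
  have h1 : Measurable fun x : EuclideanSpace ℝ (Fin n) =>
      S.core i.1 ^ 2 + ‖x - S.center i‖ ^ 2 := by fun_prop
  have h2 : Measurable fun x => S.defect i x := by
    unfold defect bubbleDefect
    exact (measurable_const.mul (continuous_profileCurv.measurable.comp
      ((Real.measurable_log.comp (measurable_const.mul h1)).div_const _))).div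
      (measurable_const.mul h1)
  exact ENNReal.measurable_ofReal.comp (h2.pow_const _)

theorem lintegral_sigmaMinus_lt_top (hn : 0 < n)
    (hsum : Summable fun k : ℕ => (S.N k : ℝ) * ((k : ℝ) + 1) ^ (1 - (n : ℝ) / 2)) :
    ∫⁻ x, ENNReal.ofReal (S.metric.sigmaMinus x ^ ((n : ℝ) / 2)) ∂S.metric.vol < ⊤ := by
  obtain ⟨C, hC0, hC⟩ := exists_profileCurv_le
  set K : ℝ := 5 * (4 * C * Real.exp 1) ^ ((n : ℝ) / 2) with hK
  have hK0 : 0 ≤ K := by positivity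
  set V := volume (_root_.Metric.ball (0 : EuclideanSpace ℝ (Fin n)) 1) with hV
  have hVtop : V ≠ ⊤ := measure_ball_lt_top.ne
  have hneck : ∀ k : ℕ, (S.N k : ℝ) * (K * neck k ^ (1 - (n : ℝ) / 2)) =
      K * (1 / 4) ^ (1 - (n : ℝ) / 2) * ((S.N k : ℝ) * ((k : ℝ) + 1) ^ (1 - (n : ℝ) / 2)) := by
    intro k
    have : neck k = (1 / 4) * ((k : ℝ) + 1) := by unfold neck; ring
    rw [this, Real.mul_rpow (by norm_num) (by positivity)]
    ring
  calc ∫⁻ x, ENNReal.ofReal (S.metric.sigmaMinus x ^ ((n : ℝ) / 2)) ∂S.metric.vol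
      ≤ ∫⁻ x, ENNReal.ofReal (Real.exp (S.exponent x) ^ n) *
          ENNReal.ofReal (S.metric.sigmaMinus x ^ ((n : ℝ) / 2)) := by
        rw [vol_eq_withDensity]
        -- The inequality suffices and asks nothing about the measurability of `sigmaMinus`.
        exact lintegral_withDensity_le_lintegral_mul _ S.measurable_density _
    _ ≤ ∫⁻ x, ∑' i, ENNReal.ofReal (S.defect i x ^ ((n : ℝ) / 2)) :=
        lintegral_mono fun x => S.sigmaMinus_rpow_mul_density_le hn x
    _ = ∑' i : S.Index, ∫⁻ x, ENNReal.ofReal (S.defect i x ^ ((n : ℝ) / 2)) :=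
        lintegral_tsum fun i => (S.measurable_defect_rpow i).aemeasurable
    _ ≤ ∑' i : S.Index, ENNReal.ofReal (K * neck i.1 ^ (1 - (n : ℝ) / 2)) * V :=
        ENNReal.tsum_le_tsum fun i => lintegral_bubbleDefect_le hn (quarter_le_neck _) S.l_pos
          (S.core_pos _) hC0.le hC _
    _ = (∑' k : ℕ, ENNReal.ofReal (K * (1 / 4) ^ (1 - (n : ℝ) / 2) *
          ((S.N k : ℝ) * ((k : ℝ) + 1) ^ (1 - (n : ℝ) / 2)))) * V := by
        rw [ENNReal.tsum_mul_right]
        congr 1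
        refine (ENNReal.tsum_sigma fun (k : ℕ) (_ : Fin (S.N k)) =>
          ENNReal.ofReal (K * neck k ^ (1 - (n : ℝ) / 2))).trans ?_
        refine tsum_congr fun k => ?_
        rw [tsum_fintype, Finset.sum_const, Finset.card_univ, Fintype.card_fin, nsmul_eq_mul,
          ← ENNReal.ofReal_natCast, ← ENNReal.ofReal_mul (by positivity), hneck]
    _ < ⊤ := by
        refine ENNReal.mul_lt_top ?_ hVtop.lt_top
        exact (hsum.mul_left _).tsum_ofReal_lt_top

end BubbleConfig

/-! ### Growth of the sequence, choice of the scale, and conclusion. -/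

theorem exists_scale_of_le {N : ℕ → ℕ} {A : ℝ} {n : ℕ} (hA : 0 ≤ A)
    (hN : ∀ k, (N k : ℝ) ≤ A * ((k : ℝ) + 1) ^ n) :
    ∃ l : ℝ, 1 ≤ l ∧ ∀ k : ℕ, 128 * Real.exp (((k : ℝ) + 1) / 4) * ((N k : ℝ) + 1) ≤ l * 2 ^ k := by
  -- Since `e^(1/4) < 2`, the sequence `(k + 1)^n r^(k+1)` is bounded: necks grow so slowly that
  -- polynomially many fit.
  set r : ℝ := Real.exp (1 / 4) / 2 with hr
  have hr0 : 0 < r := by positivity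
  have hr1 : r < 1 := by
    rw [hr, div_lt_one two_pos]
    have h1 : Real.exp (1 / 4) ≤ Real.exp (1 / 2) := Real.exp_le_exp.2 (by norm_num)
    have h2 : Real.exp (1 / 2) ^ 2 = Real.exp 1 := by
      rw [← Real.exp_nat_mul]
      norm_num
    have h3 := Real.exp_one_lt_d9
    nlinarith [Real.exp_pos (1 / 2 : ℝ)]
  have hlim : Filter.Tendsto (fun k : ℕ => ((k + 1 : ℕ) : ℝ) ^ n * r ^ (k + 1)) Filter.atTop
      (nhds 0) :=
    (tendsto_pow_const_mul_const_pow_of_lt_one n hr0.le hr1).comp (Filter.tendsto_add_atTop_nat 1)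
  obtain ⟨B, hB⟩ := hlim.bddAbove_range
  have hB' : ∀ k : ℕ, ((k : ℝ) + 1) ^ n * r ^ (k + 1) ≤ B := by
    intro k
    have := hB ⟨k, rfl⟩
    push_cast at this
    exact this
  refine ⟨max 1 (256 * (A + 1) * B), le_max_left _ _, fun k => ?_⟩
  have h1 : Real.exp (((k : ℝ) + 1) / 4) = r ^ (k + 1) * 2 ^ (k + 1) := by
    rw [hr, div_pow, div_mul_cancel₀ _ (by positivity), ← Real.exp_nat_mul]
    congr 1
    push_cast
    ring
  have h2 : (N k : ℝ) + 1 ≤ (A + 1) * ((k : ℝ) + 1) ^ n := by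
    have : (1 : ℝ) ≤ ((k : ℝ) + 1) ^ n := one_le_pow₀ (by
      have : (0 : ℝ) ≤ k := by positivity
      linarith)
    linarith [hN k]
  calc 128 * Real.exp (((k : ℝ) + 1) / 4) * ((N k : ℝ) + 1)
      ≤ 128 * (r ^ (k + 1) * 2 ^ (k + 1)) * ((A + 1) * ((k : ℝ) + 1) ^ n) := by
        rw [h1]
        gcongr
    _ = 256 * (A + 1) * (((k : ℝ) + 1) ^ n * r ^ (k + 1)) * 2 ^ k := by ring
    _ ≤ 256 * (A + 1) * B * 2 ^ k := by
        gcongr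
        exact hB' k
    _ ≤ _ := by
        gcongr
        exact le_max_right _ _

/-- Terms of a convergent series are bounded. The exponent `n` is generous, and `a 0`, which the
series does not see, is absorbed by the maximum. -/
theorem exists_forall_le_mul_pow {a : ℕ → ℝ} {n : ℕ}
    (ha : Summable fun k : ℕ => a (k + 1) * ((k : ℝ) + 1) ^ (1 - (n : ℝ) / 2)) :
    ∃ A : ℝ, 0 ≤ A ∧ ∀ k : ℕ, |a k| ≤ A * ((k : ℝ) + 1) ^ n := by
  obtain ⟨B, hB⟩ := ha.abs.tendsto_atTop_zero.bddAbove_range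
  refine ⟨max |a 0| B, (abs_nonneg _).trans (le_max_left _ _), fun k => ?_⟩
  rcases k with _ | k
  · simp
  · have hk : (0 : ℝ) < (k : ℝ) + 1 := by positivity
    have hk1 : (1 : ℝ) ≤ (k : ℝ) + 1 := by
      have : (0 : ℝ) ≤ k := by positivity
      linarith
    have h1 : |a (k + 1)| * ((k : ℝ) + 1) ^ (1 - (n : ℝ) / 2) ≤ B := by
      have := hB ⟨k, rfl⟩
      simpa only [abs_mul, abs_of_pos (Real.rpow_pos_of_pos hk _)] using this
    have h2 : ((k : ℝ) + 1) ^ (1 - (n : ℝ) / 2) * ((k : ℝ) + 1) ^ ((n : ℝ) / 2 - 1) = 1 := by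
      rw [← Real.rpow_add hk]
      simp
    have h3 : ((k : ℝ) + 1) ^ ((n : ℝ) / 2 - 1) ≤ ((k + 1 : ℕ) + 1 : ℝ) ^ n := by
      rw [← Real.rpow_natCast]
      calc ((k : ℝ) + 1) ^ ((n : ℝ) / 2 - 1) ≤ ((k : ℝ) + 1) ^ (n : ℝ) := by
            refine Real.rpow_le_rpow_of_exponent_le hk1 ?_
            have : (0 : ℝ) ≤ n := by positivity
            linarith
        _ ≤ _ := by
            refine Real.rpow_le_rpow hk.le ?_ (by positivity)
            push_cast
            linarith
    calc |a (k + 1)| = |a (k + 1)| * ((k : ℝ) + 1) ^ (1 - (n : ℝ) / 2)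
          * ((k : ℝ) + 1) ^ ((n : ℝ) / 2 - 1) := by rw [mul_assoc, h2, mul_one]
      _ ≤ max |a 0| B * ((k + 1 : ℕ) + 1 : ℝ) ^ n := by
          gcongr
          exact h1.trans (le_max_right _ _)

theorem summable_floor_mul {a : ℕ → ℝ} {n : ℕ} (hn : 2 ≤ n)
    (ha : Summable fun k : ℕ => a (k + 1) * ((k : ℝ) + 1) ^ (1 - (n : ℝ) / 2)) :
    Summable fun k : ℕ => (⌊a k⌋₊ : ℝ) * ((k : ℝ) + 1) ^ (1 - (n : ℝ) / 2) := by
  -- The necks use `k + 1` where the hypothesis has `k`. Dropping the uncontrolled term at `0`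
  -- aligns the coefficients; the larger base then only helps, the exponent being nonpositive.
  rw [← summable_nat_add_iff 1]
  refine Summable.of_nonneg_of_le (fun k => by positivity) (fun k => ?_) ha.abs
  have hk : (0 : ℝ) < (k : ℝ) + 1 := by positivity
  rw [abs_mul, abs_of_pos (Real.rpow_pos_of_pos hk _)]
  have h1 : (⌊a (k + 1)⌋₊ : ℝ) ≤ |a (k + 1)| :=
    (Nat.cast_le.2 (Nat.floor_le_floor (le_abs_self _))).trans (Nat.floor_le (abs_nonneg _))
  have h2 : ((k + 1 : ℕ) + 1 : ℝ) ^ (1 - (n : ℝ) / 2) ≤ ((k : ℝ) + 1) ^ (1 - (n : ℝ) / 2) := by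
    refine Real.rpow_le_rpow_of_nonpos hk (by push_cast; linarith) ?_
    have : (2 : ℝ) ≤ n := by exact_mod_cast hn
    linarith
  gcongr

end RiemannRn

theorem mainTheorem7 (n : ℕ) (hn : 3 ≤ n) :
    ∃ c : ℝ, 0 < c ∧
      ∀ a : ℕ → ℝ, Summable (fun k : ℕ => a (k + 1) * ((k : ℝ) + 1) ^ (1 - (n : ℝ) / 2)) →
        ∃ (f : EuclideanSpace ℝ (Fin n) → ℝ) (g : RiemannRn.Metric n),
          ContDiff ℝ ∞ f ∧
          g.IsConformal f ∧
          g.IsComplete ∧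
          g.SecBoundedBelow ∧
          (∫⁻ x, ENNReal.ofReal (g.sigmaMinus x ^ ((n : ℝ) / 2)) ∂g.vol) < ⊤ ∧
          ∀ k : ℕ, ENNReal.ofReal (c * a k * ((2 : ℝ) ^ k) ^ n) ≤ g.vol (g.ball 0 (2 ^ k)) := by
  set V := MeasureTheory.volume (Metric.ball (0 : EuclideanSpace ℝ (Fin n)) 1) with hV
  have hVtop : V ≠ ⊤ := MeasureTheory.measure_ball_lt_top.ne
  obtain ⟨v, hv0, hv⟩ : ∃ v : ℝ, 0 < v ∧ V = ENNReal.ofReal v :=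
    ⟨V.toReal, ENNReal.toReal_pos (Metric.measure_ball_pos _ _ one_pos).ne' hVtop,
      (ENNReal.ofReal_toReal hVtop).symm⟩
  -- `v` is the volume of the unit ball, `64` comes from the conformal size of a core, and `2` from
  -- `a k ≤ 2 ⌊a k⌋₊` for `a k ≥ 1`.
  refine ⟨v / (2 * 64 ^ n), by positivity, fun a ha => ?_⟩
  obtain ⟨A, hA0, hA⟩ := RiemannRn.exists_forall_le_mul_pow ha
  obtain ⟨l, hl1, hl⟩ := RiemannRn.exists_scale_of_le (N := fun k => ⌊a k⌋₊) hA0 fun k =>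
    ((Nat.cast_le.2 (Nat.floor_le_floor (le_abs_self _))).trans
      (Nat.floor_le (abs_nonneg _))).trans (hA k)
  let S : RiemannRn.BubbleConfig n :=
    { i₀ := ⟨0, by omega⟩
      i₁ := ⟨1, by omega⟩
      i₂ := ⟨2, by omega⟩
      ne₀₁ := by simp
      ne₀₂ := by simp
      ne₁₂ := by simp
      N := fun k => ⌊a k⌋₊
      l := l
      one_le_l := hl1
      scale_le := hl }
  refine ⟨S.exponent, S.metric, S.contDiff_exponent, S.isConformal_metric, S.isComplete_metric,
    S.secBoundedBelow_metric, S.lintegral_sigmaMinus_lt_top (by omega)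
      (RiemannRn.summable_floor_mul (by omega) ha), fun k => ?_⟩
  have hp : (0 : ℝ) < 2 ^ k := by positivity
  -- Below `1` there may be no bubble at all, and negative `a k` are allowed; flat space suffices
  -- there.
  rcases le_total (a k) 1 with h | h
  · refine le_trans ?_ (S.half_pow_mul_le_vol_ball k)
    rw [← hV, hv, ← ENNReal.ofReal_mul (by positivity)]
    refine ENNReal.ofReal_le_ofReal ?_
    have h1 : (2 : ℝ) ^ n ≤ 2 * 64 ^ n := by
      have : (2 : ℝ) ^ n ≤ 64 ^ n := pow_le_pow_left₀ (by norm_num) (by norm_num) n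
      have : (0 : ℝ) ≤ 64 ^ n := by positivity
      linarith
    calc v / (2 * 64 ^ n) * a k * ((2 : ℝ) ^ k) ^ n
        ≤ v / 2 ^ n * 1 * ((2 : ℝ) ^ k) ^ n := by
          have : v / (2 * 64 ^ n) * a k ≤ v / 2 ^ n * 1 := by
            calc _ ≤ v / (2 * 64 ^ n) * 1 := by gcongr
              _ ≤ _ := by gcongr
          gcongr
      _ = _ := by rw [div_pow]; ring
  · refine le_trans ?_ (S.card_mul_le_vol_ball k)
    rw [← hV, hv, ← ENNReal.ofReal_natCast, ← ENNReal.ofReal_mul (by positivity),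
      ← ENNReal.ofReal_mul (by positivity)]
    refine ENNReal.ofReal_le_ofReal ?_
    have h1 : a k ≤ 2 * (⌊a k⌋₊ : ℝ) := by
      have h2 := Nat.lt_floor_add_one (a k)
      have h3 : (1 : ℝ) ≤ ⌊a k⌋₊ := by exact_mod_cast (Nat.one_le_floor_iff _).2 h
      linarith
    calc v / (2 * 64 ^ n) * a k * ((2 : ℝ) ^ k) ^ n
        ≤ v / (2 * 64 ^ n) * (2 * (⌊a k⌋₊ : ℝ)) * ((2 : ℝ) ^ k) ^ n := by gcongr
      _ = (⌊a k⌋₊ : ℝ) * ((2 ^ k / 64) ^ n * v) := by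
          rw [div_pow]
          field_simp
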